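/- Let $(\mathcal V,\otimes,I)$ be a braided monoidal category with braiding $\sigma$ which has equalizers and coequalizers, and suppose that the tensor product preserves coequalizers in each variable. (Associativity and unit isomorphisms are suppressed below.) Let $H=(H,e_H,m_H,\varepsilon_H,\delta_H)$ be a bialgebra in $\mathcal V$, and let $A=(A,e_A,m_A)$ with $\alpha_A:A\to A\otimes H$ be a right $H$-comodule algebra, i.e. $A$ is an algebra, $\alpha_A$ is a right coaction of the coalgebra $(H,\varepsilon_H,\delta_H)$, and $\alpha_A$ is a morphism of algebras, where $A\otimes H$ carries the braided tensor product multiplication $(m_A\otimes m_H)(A\otimes\sigma_{H,A}\otimes H)$ and the unit $e_A\otimes e_H$. Put $$\lambda=\lambda_{(A,\alpha_A)}:\ H\otimes A\xrightarrow{H\otimes\alpha_A}H\otimes A\otimes H\xrightarrow{\sigma_{H,A}\otimes H}A\otimes H\otimes H\xrightarrow{A\otimes m_H}A\otimes H ,$$ the entwining structure associated with $(A,\alpha_A)$. Let $\mathcal V_A$ be the category of right $A$-modules, and let $\mathcal V_A^H(\lambda)$ be the category of entwined modules: its objects are triples $(M,\xi,\nu)$ with $(M,\xi:M\otimes A\to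 M)$ a right $A$-module and $(M,\nu:M\to M\otimes H)$ a right $H$-comodule such that $$\nu\,\xi=(\xi\otimes H)(M\otimes\lambda)(\nu\otimes A),$$ and its morphisms are the morphisms of $\mathcal V$ that are both $A$-linear and $H$-colinear. Let $i_A:A^H\to A$ be the equalizer of $\alpha_A$ and $A\otimes e_H: A\to A\otimes H$, with the algebra structure for which $i_A$ is a morphism of algebras. For a right $A^H$-module $X$, let $X\otimes_{A^H}A$ be the coequalizer of the two actions $X\otimes A^H\otimes A\rightrightarrows X\otimes A$, and let $$\bar F:\mathcal V_{A^H}\to\mathcal V_A^H(\lambda),\qquad X\mapsto\bigl(X\otimes_{A^H}A,\ X\otimes_{A^H}m_A,\ X\otimes_{A^H}\alpha_A\bigr).$$ Suppose that $H$ is flat, i.e. that the functor $-\otimes H:\mathcal V\to\mathcal V$ preserves equalizers. Then the following are equivalent: (i) $\bar F$ is an equivalence of categories; (ii) $A$ is $H$-Galois, i.e. the canonical morphism $\mathrm{can}:A\otimes_{A^H}A\to A\otimes H$ induced by $(m_A\otimes H)(A\otimes\alpha_A):A\otimes A\to A\otimes H$ is an isomorphism, and ${}_{A^H}A$ is faithfully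 flat, i.e. the functor $-\otimes_{A^H}A:\mathcal V_{A^H}\to\mathcal V_A$ is conservative and preserves equalizers. -/

import Mathlib

open CategoryTheory MonoidalCategory Limits
open scoped MonObj ComonObj

universe v u

noncomputable section

namespace BraidedGalois

variable {V : Type u} [Category.{v} V] [MonoidalCategory V]

/-! ### Right modules over an algebra -/

/-- A right module over an algebra `A` in the monoidal category `V`. -/
structure RightMod (A : Mon V) where
  X : V
  act : X ⊗ A.X ⟶ X
  act_one : X ◁ η[A.X] ≫ act = (ρ_ X).hom
  act_mul : X ◁ μ[A.X] ≫ act = (α_ X A.X A.X).inv ≫ act ▷ A.X ≫ act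

namespace RightMod


/-- A morphism of right modules. -/
@[ext]
structure Hom {A : Mon V} (M N : RightMod A) where
  hom : M.X ⟶ N.X
  act_hom : M.act ≫ hom = hom ▷ A.X ≫ N.act


/-- The category of right `A`-modules. -/
instance (A : Mon V) : Category (RightMod A) where
  Hom M N := Hom M N
  id M := ⟨𝟙 M.X, by simp⟩
  comp f g := ⟨f.hom ≫ g.hom, by
    rw [reassoc_of% f.act_hom, g.act_hom, comp_whiskerRight, Category.assoc]⟩
  id_comp f := Hom.ext (Category.id_comp f.hom)
  comp_id f := Hom.ext (Category.comp_id f.hom)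
  assoc f g h := Hom.ext (Category.assoc f.hom g.hom h.hom)

/-- The right regular module. -/
def regular (A : Mon V) : RightMod A where
  X := A.X
  act := μ[A.X]
  act_one := MonObj.mul_one A.X
  act_mul := MonObj.mul_assoc_flip A.X

/-- Restriction of scalars of a right module along a morphism of algebras. -/
def restrict {B A : Mon V} (f : B ⟶ A) (M : RightMod A) : RightMod B where
  X := M.X
  act := M.X ◁ f.hom ≫ M.act
  act_one := by
    rw [← whiskerLeft_comp_assoc, IsMonHom.one_hom, M.act_one]
  act_mul := by
    rw [← whiskerLeft_comp_assoc, IsMonHom.mul_hom, whiskerLeft_comp_assoc, M.act_mul]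
    simp only [MonoidalCategory.tensorHom_def, MonoidalCategory.whiskerLeft_comp,
      comp_whiskerRight, Category.assoc]
    rw [associator_inv_naturality_right_assoc, whisker_exchange_assoc]
    simp

end RightMod

/-- An algebra `A`, regarded as a `B`-`A`-bimodule through a morphism of algebras `B ⟶ A`. -/
def bimodOfHom {B A : Mon V} (f : B ⟶ A) : Bimod B A where
  X := A.X
  actLeft := f.hom ▷ A.X ≫ μ[A.X]
  one_actLeft := by
    rw [← comp_whiskerRight_assoc, IsMonHom.one_hom, MonObj.one_mul]
  left_assoc := by
    rw [← comp_whiskerRight_assoc, IsMonHom.mul_hom, comp_whiskerRight_assoc, MonObj.mul_assoc]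
    simp only [MonoidalCategory.tensorHom_def', MonoidalCategory.whiskerLeft_comp,
      comp_whiskerRight, Category.assoc]
    rw [associator_naturality_left_assoc, ← whisker_exchange_assoc]
    simp
  actRight := μ[A.X]
  actRight_one := MonObj.mul_one A.X
  right_assoc := MonObj.mul_assoc_flip A.X
  middle_assoc := by
    rw [comp_whiskerRight_assoc, MonObj.mul_assoc, whisker_exchange_assoc]
    simp

/-! ### The tensor product over an algebra -/

section RelativeTensor

variable [HasCoequalizers V] {S T : Mon V}

/-- The tensor product `X ⊗_S M` of a right `S`-module and an `S`-`T`-bimodule: the coequalizer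
of the two actions `X ⊗ S ⊗ M ⇉ X ⊗ M`. -/
def relTensor (X : RightMod S) (M : Bimod S T) : V :=
  coequalizer (X.act ▷ M.X) ((α_ X.X S.X M.X).hom ≫ X.X ◁ M.actLeft)

/-- The canonical epimorphism `X ⊗ M ⟶ X ⊗_S M`. -/
def relTensor.π (X : RightMod S) (M : Bimod S T) : X.X ⊗ M.X ⟶ relTensor X M :=
  coequalizer.π _ _

instance (X : RightMod S) (M : Bimod S T) : Epi (relTensor.π X M) :=
  inferInstanceAs (Epi (coequalizer.π _ _))

lemma relTensor.condition (X : RightMod S) (M : Bimod S T) :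
    X.act ▷ M.X ≫ relTensor.π X M =
      (α_ X.X S.X M.X).hom ≫ X.X ◁ M.actLeft ≫ relTensor.π X M :=
  (coequalizer.condition (X.act ▷ M.X) ((α_ X.X S.X M.X).hom ≫ X.X ◁ M.actLeft)).trans
    (by rw [Category.assoc]; rfl)

/-- The morphism out of `X ⊗_S M` induced by an `S`-balanced morphism. -/
def relTensor.desc (X : RightMod S) (M : Bimod S T) {W : V} (k : X.X ⊗ M.X ⟶ W)
    (hk : X.act ▷ M.X ≫ k = (α_ X.X S.X M.X).hom ≫ X.X ◁ M.actLeft ≫ k) :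
    relTensor X M ⟶ W :=
  coequalizer.desc k (by simpa using hk)

@[simp]
lemma relTensor.π_desc (X : RightMod S) (M : Bimod S T) {W : V} (k : X.X ⊗ M.X ⟶ W)
    (hk : X.act ▷ M.X ≫ k = (α_ X.X S.X M.X).hom ≫ X.X ◁ M.actLeft ≫ k) :
    relTensor.π X M ≫ relTensor.desc X M k hk = k :=
  coequalizer.π_desc _ _

/-- Functoriality of `X ⊗_S M` in `X`. -/
def relTensor.map {X Y : RightMod S} (f : X ⟶ Y) (M : Bimod S T) :
    relTensor X M ⟶ relTensor Y M :=
  relTensor.desc X M (f.hom ▷ M.X ≫ relTensor.π Y M) (by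
    rw [← comp_whiskerRight_assoc, f.act_hom, comp_whiskerRight_assoc, relTensor.condition,
      whisker_exchange_assoc]
    simp)

@[simp]
lemma relTensor.π_map {X Y : RightMod S} (f : X ⟶ Y) (M : Bimod S T) :
    relTensor.π X M ≫ relTensor.map f M = f.hom ▷ M.X ≫ relTensor.π Y M :=
  relTensor.π_desc _ _ _ _

section TensorCoaction

/-- The morphism `X ⊗_S c : X ⊗_S M ⟶ (X ⊗_S M) ⊗ C` for a left `S`-linear `c : M ⟶ M ⊗ C`. -/
def relTensor.coact (X : RightMod S) (M : Bimod S T) {C : V} (c : M.X ⟶ M.X ⊗ C)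
    (hc : M.actLeft ≫ c = S.X ◁ c ≫ (α_ S.X M.X C).inv ≫ M.actLeft ▷ C) :
    relTensor X M ⟶ relTensor X M ⊗ C :=
  relTensor.desc X M (X.X ◁ c ≫ (α_ X.X M.X C).inv ≫ relTensor.π X M ▷ C) (by
    rw [← whisker_exchange_assoc, ← MonoidalCategory.whiskerLeft_comp_assoc, hc,
      associator_inv_naturality_left_assoc, ← comp_whiskerRight, relTensor.condition]
    monoidal)

variable (X : RightMod S) (M : Bimod S T) {C : V} (c : M.X ⟶ M.X ⊗ C)
    (hc : M.actLeft ≫ c = S.X ◁ c ≫ (α_ S.X M.X C).inv ≫ M.actLeft ▷ C)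

@[simp]
lemma relTensor.π_coact : relTensor.π X M ≫ relTensor.coact X M c hc =
    X.X ◁ c ≫ (α_ X.X M.X C).inv ≫ relTensor.π X M ▷ C :=
  relTensor.π_desc _ _ _ _

lemma relTensor.coact_counit [ComonObj C] (h : c ≫ M.X ◁ ε[C] = (ρ_ M.X).inv) :
    relTensor.coact X M c hc ≫ relTensor X M ◁ ε[C] = (ρ_ (relTensor X M)).inv := by
  rw [← cancel_epi (relTensor.π X M), reassoc_of% relTensor.π_coact, ← whisker_exchange]
  calc _ = X.X ◁ (c ≫ M.X ◁ ε[C]) ⊗≫ relTensor.π X M ▷ 𝟙_ V := by monoidal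
    _ = _ := by rw [h]; monoidal

lemma relTensor.coact_comul [ComonObj C]
    (h : c ≫ M.X ◁ Δ[C] = c ≫ c ▷ C ≫ (α_ M.X C C).hom) :
    relTensor.coact X M c hc ≫ relTensor X M ◁ Δ[C] =
      relTensor.coact X M c hc ≫ relTensor.coact X M c hc ▷ C ≫ (α_ (relTensor X M) C C).hom := by
  rw [← cancel_epi (relTensor.π X M), reassoc_of% relTensor.π_coact, reassoc_of% relTensor.π_coact,
    ← whisker_exchange, ← comp_whiskerRight_assoc, relTensor.π_coact]
  calc _ = X.X ◁ (c ≫ M.X ◁ Δ[C]) ⊗≫ relTensor.π X M ▷ (C ⊗ C) := by monoidal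
    _ = _ := by rw [h]; monoidal

lemma relTensor.map_coact {X Y : RightMod S} (f : X ⟶ Y) :
    relTensor.coact X M c hc ≫ relTensor.map f M ▷ C =
      relTensor.map f M ≫ relTensor.coact Y M c hc := by
  rw [← cancel_epi (relTensor.π X M), reassoc_of% relTensor.π_coact, reassoc_of% relTensor.π_map,
    relTensor.π_coact, ← comp_whiskerRight, relTensor.π_map, ← whisker_exchange_assoc]
  monoidal

end TensorCoaction

variable [∀ X : V, PreservesColimitsOfShape WalkingParallelPair (tensorRight X)]

instance relTensor.epi_π_whiskerRight (X : RightMod S) (M : Bimod S T) (Z : V) :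
    Epi (relTensor.π X M ▷ Z) :=
  inferInstanceAs (Epi ((tensorRight Z).map (coequalizer.π _ _)))

/-- The morphism out of `(X ⊗_S M) ⊗ Z` induced by an `S`-balanced morphism; it exists since
`- ⊗ Z` preserves coequalizers. -/
def relTensor.descRight (X : RightMod S) (M : Bimod S T) {Z W : V} (k : (X.X ⊗ M.X) ⊗ Z ⟶ W)
    (hk : X.act ▷ M.X ▷ Z ≫ k = (α_ X.X S.X M.X).hom ▷ Z ≫ (X.X ◁ M.actLeft) ▷ Z ≫ k) :
    relTensor X M ⊗ Z ⟶ W :=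
  (PreservesCoequalizer.iso (tensorRight Z) _ _).inv ≫ coequalizer.desc k (by simpa using hk)

@[simp]
lemma relTensor.π_descRight (X : RightMod S) (M : Bimod S T) {Z W : V}
    (k : (X.X ⊗ M.X) ⊗ Z ⟶ W)
    (hk : X.act ▷ M.X ▷ Z ≫ k = (α_ X.X S.X M.X).hom ▷ Z ≫ (X.X ◁ M.actLeft) ▷ Z ≫ k) :
    relTensor.π X M ▷ Z ≫ relTensor.descRight X M k hk = k :=
  map_π_preserves_coequalizer_inv_desc (tensorRight Z) _ _ k _

/-- The right action of `T` on `X ⊗_S M`, namely `X ⊗_S` (right action on `M`). -/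
def relTensor.act (X : RightMod S) (M : Bimod S T) : relTensor X M ⊗ T.X ⟶ relTensor X M :=
  relTensor.descRight X M ((α_ X.X M.X T.X).hom ≫ X.X ◁ M.actRight ≫ relTensor.π X M) (by
    have h : X.act ▷ M.X ▷ T.X ≫ (α_ X.X M.X T.X).hom ≫ X.X ◁ M.actRight ≫ relTensor.π X M =
        (α_ _ _ _).hom ≫ (α_ _ _ _).hom ≫ X.X ◁ S.X ◁ M.actRight ≫ X.X ◁ M.actLeft ≫
          relTensor.π X M := by
      rw [associator_naturality_left_assoc, ← whisker_exchange_assoc, relTensor.condition]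
      simp
    rw [h, associator_naturality_middle_assoc, ← whiskerLeft_comp_assoc X.X (M.actLeft ▷ T.X),
      M.middle_assoc]
    simp)

@[simp]
lemma relTensor.π_act (X : RightMod S) (M : Bimod S T) :
    relTensor.π X M ▷ T.X ≫ relTensor.act X M =
      (α_ X.X M.X T.X).hom ≫ X.X ◁ M.actRight ≫ relTensor.π X M :=
  relTensor.π_descRight _ _ _ _

lemma relTensor.coact_compat (X : RightMod S) (M : Bimod S T) {C : V} (c : M.X ⟶ M.X ⊗ C)
    (hc : M.actLeft ≫ c = S.X ◁ c ≫ (α_ S.X M.X C).inv ≫ M.actLeft ▷ C)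
    (lam : C ⊗ T.X ⟶ T.X ⊗ C)
    (h : M.actRight ≫ c = c ▷ T.X ≫ (α_ M.X C T.X).hom ≫ M.X ◁ lam ≫
      (α_ M.X T.X C).inv ≫ M.actRight ▷ C) :
    relTensor.act X M ≫ relTensor.coact X M c hc =
      relTensor.coact X M c hc ▷ T.X ≫ (α_ (relTensor X M) C T.X).hom ≫
        relTensor X M ◁ lam ≫ (α_ (relTensor X M) T.X C).inv ≫ relTensor.act X M ▷ C := by
  rw [← cancel_epi (relTensor.π X M ▷ T.X), reassoc_of% relTensor.π_act, relTensor.π_coact,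
    ← MonoidalCategory.whiskerLeft_comp_assoc, h, ← comp_whiskerRight_assoc, relTensor.π_coact]
  symm
  calc (X.X ◁ c ≫ (α_ X.X M.X C).inv ≫ relTensor.π X M ▷ C) ▷ T.X ≫
        (α_ (relTensor X M) C T.X).hom ≫ relTensor X M ◁ lam ≫
          (α_ (relTensor X M) T.X C).inv ≫ relTensor.act X M ▷ C =
        (X.X ◁ c) ▷ T.X ⊗≫ (relTensor.π X M ▷ (C ⊗ T.X) ≫ relTensor X M ◁ lam) ⊗≫
        relTensor.act X M ▷ C := by monoidal
    _ = (X.X ◁ c) ▷ T.X ⊗≫ (X.X ⊗ M.X) ◁ lam ⊗≫ (relTensor.π X M ▷ T.X ≫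
        relTensor.act X M) ▷ C := by
          rw [← whisker_exchange]; monoidal
    _ = (X.X ◁ c) ▷ T.X ⊗≫ (X.X ⊗ M.X) ◁ lam ⊗≫ ((α_ X.X M.X T.X).hom ≫ X.X ◁ M.actRight ≫
        relTensor.π X M) ▷ C := by rw [relTensor.π_act]
    _ = _ := by monoidal

/-- The right `T`-module `X ⊗_S M`. -/
def relTensor.rightMod (X : RightMod S) (M : Bimod S T) : RightMod T where
  X := relTensor X M
  act := relTensor.act X M
  act_one := by
    rw [← cancel_epi (relTensor.π X M ▷ 𝟙_ V), ← whisker_exchange_assoc, relTensor.π_act,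
      associator_naturality_right_assoc, ← whiskerLeft_comp_assoc, M.actRight_one]
    simp
  act_mul := by
    rw [← cancel_epi (relTensor.π X M ▷ (T.X ⊗ T.X)), ← whisker_exchange_assoc,
      relTensor.π_act, associator_naturality_right_assoc, ← whiskerLeft_comp_assoc,
      M.right_assoc, associator_inv_naturality_left_assoc, ← comp_whiskerRight_assoc,
      relTensor.π_act]
    simp

/-- The functor `- ⊗_S M` from right `S`-modules to right `T`-modules, for a bimodule `M`. -/
def tensorFunctor (M : Bimod S T) : RightMod S ⥤ RightMod T where
  obj X := relTensor.rightMod X M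
  map {X Y} f := ⟨relTensor.map f M, by
    change relTensor.act X M ≫ relTensor.map f M = relTensor.map f M ▷ T.X ≫ relTensor.act Y M
    rw [← cancel_epi (relTensor.π X M ▷ T.X), reassoc_of% relTensor.π_act, relTensor.π_map,
      ← comp_whiskerRight_assoc, relTensor.π_map, comp_whiskerRight_assoc, relTensor.π_act,
      associator_naturality_left_assoc, whisker_exchange_assoc]⟩
  map_id X := RightMod.Hom.ext (by
    change relTensor.map (𝟙 X) M = 𝟙 (relTensor X M)
    rw [← cancel_epi (relTensor.π X M), relTensor.π_map]
    change 𝟙 X.X ▷ M.X ≫ _ = _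
    simp)
  map_comp {X Y Z} f g := RightMod.Hom.ext (by
    change relTensor.map (f ≫ g) M = relTensor.map f M ≫ relTensor.map g M
    rw [← cancel_epi (relTensor.π X M), relTensor.π_map, reassoc_of% relTensor.π_map, relTensor.π_map]
    change (f.hom ≫ g.hom) ▷ M.X ≫ _ = _
    simp)

/-- The left `S`-module underlying an `S`-`T`-bimodule `M` is flat if the functor `- ⊗_S M`
preserves equalizers. -/
def LeftFlat (M : Bimod S T) : Prop :=
  PreservesLimitsOfShape WalkingParallelPair (tensorFunctor M)

/-- The left `S`-module underlying an `S`-`T`-bimodule `M` is faithfully flat if the functor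
`- ⊗_S M` is conservative and preserves equalizers. -/
def LeftFaithfullyFlat (M : Bimod S T) : Prop :=
  (tensorFunctor M).ReflectsIsomorphisms ∧ LeftFlat M

end RelativeTensor

/-- An object `C` of `V` is flat if `- ⊗ C` preserves equalizers. -/
def FlatObj (C : V) : Prop :=
  PreservesLimitsOfShape WalkingParallelPair (tensorRight C)

/-! ### Entwining structures and entwined modules -/

/-- An entwining structure between a coalgebra `C` and an algebra `A`: a morphism
`C ⊗ A ⟶ A ⊗ C` such that `- ⊗ C ⊗ A ⟶ - ⊗ A ⊗ C` is a mixed distributive law from the monad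
`- ⊗ A` to the comonad `- ⊗ C`. -/
structure Entwining (C : V) [ComonObj C] (A : Mon V) where
  lam : C ⊗ A.X ⟶ A.X ⊗ C
  one_lam : C ◁ η[A.X] ≫ lam = (ρ_ C).hom ≫ (λ_ C).inv ≫ η[A.X] ▷ C
  lam_counit : lam ≫ A.X ◁ ε[C] = ε[C] ▷ A.X ≫ (λ_ A.X).hom ≫ (ρ_ A.X).inv
  lam_comul : lam ≫ A.X ◁ Δ[C] =
    Δ[C] ▷ A.X ≫ (α_ C C A.X).hom ≫ C ◁ lam ≫ (α_ C A.X C).inv ≫ lam ▷ C ≫ (α_ A.X C C).hom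
  mul_lam : C ◁ μ[A.X] ≫ lam =
    (α_ C A.X A.X).inv ≫ lam ▷ A.X ≫ (α_ A.X C A.X).hom ≫ A.X ◁ lam ≫
      (α_ A.X A.X C).inv ≫ μ[A.X] ▷ C

/-- An entwined module: a right `A`-module that is a right `C`-comodule, with the compatibility
between action and coaction prescribed by the entwining structure. -/
structure EntwinedModule {C : V} [ComonObj C] {A : Mon V} (E : Entwining C A) extends
    RightMod A where
  coact : X ⟶ X ⊗ C
  coact_counit : coact ≫ X ◁ ε[C] = (ρ_ X).inv
  coact_comul : coact ≫ X ◁ Δ[C] = coact ≫ coact ▷ C ≫ (α_ X C C).hom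
  compat : act ≫ coact =
    coact ▷ A.X ≫ (α_ X C A.X).hom ≫ X ◁ E.lam ≫ (α_ X A.X C).inv ≫ act ▷ C

namespace EntwinedModule

variable {C : V} [ComonObj C] {A : Mon V} {E : Entwining C A}

/-- A morphism of entwined modules: a morphism of right modules and of right comodules. -/
@[ext]
structure Hom (M N : EntwinedModule E) where
  hom : M.X ⟶ N.X
  act_hom : M.act ≫ hom = hom ▷ A.X ≫ N.act
  coact_hom : M.coact ≫ hom ▷ C = hom ≫ N.coact


/-- The category of entwined modules. -/
instance : Category (EntwinedModule E) where
  Hom M N := Hom M N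
  id M := ⟨𝟙 M.X, by simp, by simp⟩
  comp f g := ⟨f.hom ≫ g.hom, by
    rw [reassoc_of% f.act_hom, g.act_hom, comp_whiskerRight, Category.assoc], by
    rw [comp_whiskerRight, reassoc_of% f.coact_hom, g.coact_hom, Category.assoc]⟩
  id_comp f := Hom.ext (Category.id_comp f.hom)
  comp_id f := Hom.ext (Category.comp_id f.hom)
  assoc f g h := Hom.ext (Category.assoc f.hom g.hom h.hom)

end EntwinedModule

/-! ### Equalizers of algebra morphisms -/

section EqualizerAlgebra

variable [HasEqualizers V] {M N : V} [MonObj M] [MonObj N] (f g : M ⟶ N) [IsMonHom f] [IsMonHom g]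

/-- The algebra structure on the equalizer of two algebra morphisms, for which the inclusion is an
algebra morphism. -/
instance equalizerMonObj : MonObj (equalizer f g) where
  one := equalizer.lift η[M] (by rw [IsMonHom.one_hom, IsMonHom.one_hom])
  mul := equalizer.lift ((equalizer.ι f g ⊗ₘ equalizer.ι f g) ≫ μ[M]) (by
    rw [Category.assoc, Category.assoc, IsMonHom.mul_hom, IsMonHom.mul_hom,
      tensorHom_comp_tensorHom_assoc, tensorHom_comp_tensorHom_assoc, equalizer.condition])
  one_mul := by
    apply equalizer.hom_ext
    rw [Category.assoc, equalizer.lift_ι, ← tensorHom_id, tensorHom_comp_tensorHom_assoc,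
      equalizer.lift_ι, Category.id_comp, MonObj.one_mul_hom]
  mul_one := by
    apply equalizer.hom_ext
    rw [Category.assoc, equalizer.lift_ι, ← id_tensorHom, tensorHom_comp_tensorHom_assoc,
      equalizer.lift_ι, Category.id_comp, MonObj.mul_one_hom]
  mul_assoc := by
    apply equalizer.hom_ext
    simp only [Category.assoc, equalizer.lift_ι, ← id_tensorHom, ← tensorHom_id,
      tensorHom_comp_tensorHom_assoc, Category.id_comp]
    rw [MonoidalCategory.tensorHom_def (_ ≫ _) (equalizer.ι f g), comp_whiskerRight,
      Category.assoc, Category.assoc, ← whisker_exchange_assoc, MonObj.mul_assoc]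
    simp [MonoidalCategory.tensorHom_def]

instance : IsMonHom (equalizer.ι f g) where
  one_hom := equalizer.lift_ι _ _
  mul_hom := equalizer.lift_ι _ _

end EqualizerAlgebra

/-! ### Comodule algebras over a bialgebra -/

variable [BraidedCategory V]

/-- A right comodule algebra over a bialgebra `H`: an algebra with a right `H`-coaction that is a
morphism of algebras into `A ⊗ H`. -/
structure ComoduleAlgebra (H : V) [BimonObj H] where
  alg : Mon V
  coact : alg.X ⟶ alg.X ⊗ H
  coact_counit : coact ≫ alg.X ◁ ε[H] = (ρ_ alg.X).inv
  coact_comul : coact ≫ alg.X ◁ Δ[H] = coact ≫ coact ▷ H ≫ (α_ alg.X H H).hom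
  isMonHom_coact : IsMonHom coact

namespace ComoduleAlgebra

attribute [instance] isMonHom_coact

variable {H : V} [BimonObj H] (A : ComoduleAlgebra H)

/-- The morphism `H ⊗ A ⟶ A ⊗ H` obtained by coacting on `A`, braiding `H` past `A`, and
multiplying in `H`. -/
def lam : H ⊗ A.alg.X ⟶ A.alg.X ⊗ H :=
  H ◁ A.coact ≫ (α_ H A.alg.X H).inv ≫ (β_ H A.alg.X).hom ▷ H ≫ (α_ A.alg.X H H).hom ≫
    A.alg.X ◁ μ[H]

lemma mul_coact : μ[A.alg.X] ≫ A.coact =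
    A.coact ▷ A.alg.X ≫ (α_ _ _ _).hom ≫ A.alg.X ◁ A.lam ≫ (α_ _ _ _).inv ≫ μ[A.alg.X] ▷ H := by
  rw [IsMonHom.mul_hom, MonObj.tensorObj.mul_def, tensorμ, lam]
  have h : (α_ A.alg.X (A.alg.X ⊗ H) H).inv ≫ (α_ A.alg.X A.alg.X H).inv ▷ H ≫
      μ[A.alg.X] ▷ H ▷ H ≫ (α_ A.alg.X H H).hom ≫ A.alg.X ◁ μ[H] =
      A.alg.X ◁ (α_ A.alg.X H H).hom ≫ A.alg.X ◁ A.alg.X ◁ μ[H] ≫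
        (α_ A.alg.X A.alg.X H).inv ≫ μ[A.alg.X] ▷ H := by
    rw [associator_naturality_left_assoc, ← whisker_exchange]
    simp
  simp [MonoidalCategory.tensorHom_def, h]

/-- The entwining structure of a comodule algebra. -/
def entwining : Entwining H A.alg where
  lam := A.lam
  one_lam := by
    have h : H ◁ (λ_ (𝟙_ V)).inv ≫ H ◁ η[A.alg.X] ▷ 𝟙_ V ≫ H ◁ A.alg.X ◁ η[H] ≫
        (α_ H A.alg.X H).inv = H ◁ η[H] ⊗≫ H ◁ η[A.alg.X] ▷ H ⊗≫ 𝟙 _ := by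
      rw [← MonoidalCategory.whiskerLeft_comp_assoc _ (_ ▷ _), ← whisker_exchange]
      monoidal
    rw [lam, ← whiskerLeft_comp_assoc, IsMonHom.one_hom, MonObj.tensorObj.one_def,
      MonoidalCategory.tensorHom_def]
    simp only [MonoidalCategory.whiskerLeft_comp, Category.assoc, reassoc_of% h]
    calc _ = H ◁ η[H] ⊗≫ (H ◁ η[A.alg.X] ≫ (β_ H A.alg.X).hom) ▷ H ⊗≫ A.alg.X ◁ μ[H] := by
          monoidal
      _ = H ◁ η[H] ⊗≫ (η[A.alg.X] ▷ (H ⊗ H) ≫ A.alg.X ◁ μ[H]) := by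
          rw [BraidedCategory.braiding_naturality_right, braiding_tensorUnit_right]
          monoidal
      _ = 𝟙 _ ⊗≫ (H ◁ η[H] ≫ μ[H]) ⊗≫ η[A.alg.X] ▷ H := by
          rw [← whisker_exchange]
          monoidal
      _ = _ := by
          rw [MonObj.mul_one]
          monoidal
  lam_counit := by
    have h : μ[H] ≫ ε[H] = H ◁ ε[H] ⊗≫ ε[H] := by
      rw [BimonObj.mul_counit, Comon.tensorObj_counit, MonoidalCategory.tensorHom_def']
      monoidal
    simp only [lam, Category.assoc]
    rw [← MonoidalCategory.whiskerLeft_comp, h]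
    calc _ = H ◁ A.coact ⊗≫ ((β_ H A.alg.X).hom ▷ H ≫ (A.alg.X ⊗ H) ◁ ε[H]) ⊗≫
            A.alg.X ◁ ε[H] := by monoidal
      _ = H ◁ (A.coact ≫ A.alg.X ◁ ε[H]) ⊗≫ ((β_ H A.alg.X).hom ≫ A.alg.X ◁ ε[H]) := by
          rw [← whisker_exchange]
          monoidal
      _ = _ := by
          rw [A.coact_counit, ← BraidedCategory.braiding_naturality_left,
            braiding_tensorUnit_left]
          monoidal
  lam_comul := by
    have h := A.coact_comul
    calc A.lam ≫ A.alg.X ◁ Δ[H] =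
        Δ[H] ▷ A.alg.X ≫ (H ⊗ H) ◁ (A.coact ≫ A.alg.X ◁ Δ[H]) ⊗≫
          H ◁ (β_ H A.alg.X).hom ▷ (H ⊗ H) ⊗≫ (β_ H A.alg.X).hom ▷ (H ⊗ H ⊗ H) ⊗≫
          (A.alg.X ⊗ H) ◁ (β_ H H).hom ▷ H ⊗≫ A.alg.X ◁ (μ[H] ⊗ₘ μ[H]) := by
          rw [lam]
          simp only [Category.assoc]
          rw [← MonoidalCategory.whiskerLeft_comp, BimonObj.mul_comul, tensorμ,
            MonoidalCategory.tensorHom_def Δ[H]]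
          calc _ = H ◁ A.coact ⊗≫ (β_ H A.alg.X).hom ▷ H ⊗≫
              A.alg.X ◁ (Δ[H] ▷ H ≫ (H ⊗ H) ◁ Δ[H]) ⊗≫
              (A.alg.X ⊗ H) ◁ (β_ H H).hom ▷ H ⊗≫ A.alg.X ◁ (μ[H] ⊗ₘ μ[H]) := by monoidal
            _ = H ◁ A.coact ⊗≫ ((β_ H A.alg.X).hom ▷ H ≫
              (A.alg.X ⊗ H) ◁ Δ[H]) ⊗≫ A.alg.X ◁ Δ[H] ▷ (H ⊗ H) ⊗≫
              (A.alg.X ⊗ H) ◁ (β_ H H).hom ▷ H ⊗≫ A.alg.X ◁ (μ[H] ⊗ₘ μ[H]) := by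
                rw [← whisker_exchange]; monoidal
            _ = H ◁ (A.coact ≫ A.alg.X ◁ Δ[H]) ⊗≫ ((β_ H A.alg.X).hom ≫
              A.alg.X ◁ Δ[H]) ▷ (H ⊗ H) ⊗≫
              (A.alg.X ⊗ H) ◁ (β_ H H).hom ▷ H ⊗≫ A.alg.X ◁ (μ[H] ⊗ₘ μ[H]) := by
                rw [← whisker_exchange]; monoidal
            _ = (H ◁ (A.coact ≫ A.alg.X ◁ Δ[H]) ≫ Δ[H] ▷ (A.alg.X ⊗ H ⊗ H)) ⊗≫
              (β_ (H ⊗ H) A.alg.X).hom ▷ (H ⊗ H) ⊗≫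
              (A.alg.X ⊗ H) ◁ (β_ H H).hom ▷ H ⊗≫ A.alg.X ◁ (μ[H] ⊗ₘ μ[H]) := by
                rw [← BraidedCategory.braiding_naturality_left]; monoidal
            _ = _ := by
                rw [whisker_exchange, BraidedCategory.braiding_tensor_left_hom]; monoidal
      _ = Δ[H] ▷ A.alg.X ≫ (H ⊗ H) ◁ (A.coact ≫ A.coact ▷ H ≫ (α_ A.alg.X H H).hom) ⊗≫
          H ◁ (β_ H A.alg.X).hom ▷ (H ⊗ H) ⊗≫
          (H ⊗ A.alg.X) ◁ (β_ H H).hom ▷ H ⊗≫ (H ⊗ A.alg.X ⊗ H) ◁ μ[H] ⊗≫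
          (β_ H A.alg.X).hom ▷ (H ⊗ H) ⊗≫
          A.alg.X ◁ μ[H] ▷ H ⊗≫ 𝟙 _ := by
          rw [h, MonoidalCategory.tensorHom_def']
          calc _ = Δ[H] ▷ A.alg.X ≫ (H ⊗ H) ◁ (A.coact ≫ A.coact ▷ H ≫ (α_ A.alg.X H H).hom) ⊗≫
            H ◁ (β_ H A.alg.X).hom ▷ (H ⊗ H) ⊗≫ ((β_ H A.alg.X).hom ▷ ((H ⊗ H) ⊗ H) ≫
            (A.alg.X ⊗ H) ◁ ((β_ H H).hom ▷ H)) ⊗≫ (A.alg.X ⊗ H ⊗ H) ◁ μ[H] ⊗≫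
            A.alg.X ◁ μ[H] ▷ H := by monoidal
           _ = Δ[H] ▷ A.alg.X ≫ (H ⊗ H) ◁ (A.coact ≫ A.coact ▷ H ≫ (α_ A.alg.X H H).hom) ⊗≫
            H ◁ (β_ H A.alg.X).hom ▷ (H ⊗ H) ⊗≫
            (H ⊗ A.alg.X) ◁ ((β_ H H).hom ▷ H) ⊗≫ ((β_ H A.alg.X).hom ▷ (H ⊗ (H ⊗ H)) ≫
            (A.alg.X ⊗ H) ◁ (H ◁ μ[H])) ⊗≫
            A.alg.X ◁ μ[H] ▷ H := by rw [← whisker_exchange]; monoidal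
           _ = _ := by rw [← whisker_exchange]; monoidal
      _ = _ := by
          symm
          rw [lam]
          calc _ = Δ[H] ▷ A.alg.X ⊗≫ (H ⊗ H) ◁ A.coact ⊗≫ H ◁ (β_ H A.alg.X).hom ▷ H ⊗≫
             ((H ⊗ A.alg.X) ◁ μ[H] ≫ (H ◁ A.coact) ▷ H) ⊗≫ (β_ H A.alg.X).hom ▷ (H ⊗ H) ⊗≫
             A.alg.X ◁ μ[H] ▷ H ⊗≫ 𝟙 _ := by monoidal
           _ = Δ[H] ▷ A.alg.X ⊗≫ (H ⊗ H) ◁ A.coact ⊗≫ H ◁ ((β_ H A.alg.X).hom ≫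
             A.coact ▷ H) ▷ H ⊗≫
             (H ⊗ A.alg.X ⊗ H) ◁ μ[H] ⊗≫ (β_ H A.alg.X).hom ▷ (H ⊗ H) ⊗≫
             A.alg.X ◁ μ[H] ▷ H ⊗≫ 𝟙 _ := by rw [whisker_exchange]; monoidal
           _ = _ := by
            rw [← BraidedCategory.braiding_naturality_right,
              BraidedCategory.braiding_tensor_right_hom]; monoidal
  mul_lam := by
    calc H ◁ μ[A.alg.X] ≫ A.lam = H ◁ A.coact ▷ A.alg.X ⊗≫ (H ⊗ A.alg.X) ◁ A.lam ⊗≫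
          (β_ H A.alg.X).hom ▷ (A.alg.X ⊗ H) ⊗≫ A.alg.X ◁ (β_ H A.alg.X).hom ▷ H ⊗≫
          (A.alg.X ⊗ A.alg.X) ◁ μ[H] ⊗≫ μ[A.alg.X] ▷ H := by
          nth_rw 1 [lam]
          rw [← whiskerLeft_comp_assoc, mul_coact]
          calc _ = H ◁ A.coact ▷ A.alg.X ⊗≫ (H ⊗ A.alg.X) ◁ A.lam ⊗≫
                (H ◁ μ[A.alg.X] ≫ (β_ H A.alg.X).hom) ▷ H ⊗≫ A.alg.X ◁ μ[H] := by monoidal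
            _ = H ◁ A.coact ▷ A.alg.X ⊗≫ (H ⊗ A.alg.X) ◁ A.lam ⊗≫
                (β_ H A.alg.X).hom ▷ (A.alg.X ⊗ H) ⊗≫ A.alg.X ◁ (β_ H A.alg.X).hom ▷ H ⊗≫
                (μ[A.alg.X] ▷ (H ⊗ H) ≫ A.alg.X ◁ μ[H]) := by
                rw [BraidedCategory.braiding_naturality_right,
                  BraidedCategory.braiding_tensor_right_hom]; monoidal
            _ = _ := by rw [← whisker_exchange]; monoidal
      _ = H ◁ A.coact ▷ A.alg.X ⊗≫ (β_ H A.alg.X).hom ▷ (H ⊗ A.alg.X) ⊗≫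
           (A.alg.X ⊗ H) ◁ A.lam ⊗≫ A.alg.X ◁ (β_ H A.alg.X).hom ▷ H ⊗≫
          (A.alg.X ⊗ A.alg.X) ◁ μ[H] ⊗≫ μ[A.alg.X] ▷ H := by
          calc _ = H ◁ A.coact ▷ A.alg.X ⊗≫ ((H ⊗ A.alg.X) ◁ A.lam ≫
              (β_ H A.alg.X).hom ▷ (A.alg.X ⊗ H)) ⊗≫ A.alg.X ◁ (β_ H A.alg.X).hom ▷ H ⊗≫
              (A.alg.X ⊗ A.alg.X) ◁ μ[H] ⊗≫ μ[A.alg.X] ▷ H := by monoidal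
            _ = _ := by rw [whisker_exchange]; monoidal
      _ = H ◁ A.coact ▷ A.alg.X ⊗≫ (β_ H A.alg.X).hom ▷ (H ⊗ A.alg.X) ⊗≫
           A.alg.X ◁ (μ[H] ▷ A.alg.X ≫ A.lam) ⊗≫ μ[A.alg.X] ▷ H := by
          have h : μ[H] ▷ A.alg.X ≫ A.lam =
              𝟙 _ ⊗≫ H ◁ A.lam ⊗≫ (β_ H A.alg.X).hom ▷ H ⊗≫ A.alg.X ◁ μ[H] := by
            rw [lam, ← whisker_exchange_assoc]
            calc _ = (H ⊗ H) ◁ A.coact ⊗≫ (μ[H] ▷ A.alg.X ≫ (β_ H A.alg.X).hom) ▷ H ⊗≫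
                  A.alg.X ◁ μ[H] := by monoidal
              _ = (H ⊗ H) ◁ A.coact ⊗≫ H ◁ (β_ H A.alg.X).hom ▷ H ⊗≫
                  (β_ H A.alg.X).hom ▷ (H ⊗ H) ⊗≫ A.alg.X ◁ (μ[H] ▷ H ≫ μ[H]) := by
                  rw [BraidedCategory.braiding_naturality_left,
                    BraidedCategory.braiding_tensor_left_hom]; monoidal
              _ = (H ⊗ H) ◁ A.coact ⊗≫ H ◁ (β_ H A.alg.X).hom ▷ H ⊗≫
                  ((β_ H A.alg.X).hom ▷ (H ⊗ H) ≫ (A.alg.X ⊗ H) ◁ μ[H]) ⊗≫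
                  A.alg.X ◁ μ[H] := by
                  rw [MonObj.mul_assoc]; monoidal
              _ = _ := by rw [← whisker_exchange]; monoidal
          rw [h]; monoidal
      _ = _ := by
          nth_rw 2 [lam]
          monoidal

/-- The trivial coaction `A ⊗ e_H : A ⟶ A ⊗ H`. -/
def trivialCoact : A.alg.X ⟶ A.alg.X ⊗ H := (ρ_ A.alg.X).inv ≫ A.alg.X ◁ η[H]

instance : IsMonHom (η[H] : 𝟙_ V ⟶ H) where
  mul_hom := by simp [unitors_equal]

instance : IsMonHom A.trivialCoact :=
  inferInstanceAs (IsMonHom ((ρ_ A.alg.X).inv ≫ A.alg.X ◁ η[H]))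

variable [HasEqualizers V]

/-- The algebra of coinvariants `A^H`: the equalizer of the coaction and of `A ⊗ e_H`. -/
def coinv : Mon V := ⟨equalizer A.coact A.trivialCoact⟩

/-- The inclusion `i_A : A^H ⟶ A`, a morphism of algebras. -/
def incl : A.coinv ⟶ A.alg where
  hom := equalizer.ι A.coact A.trivialCoact
  isMonHom_hom := inferInstanceAs (IsMonHom (equalizer.ι A.coact A.trivialCoact))

/-- The algebra `A` as an `A^H`-`A`-bimodule. -/
def bimod : Bimod A.coinv A.alg := bimodOfHom A.incl

/-- The coaction is left `A^H`-linear. -/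
lemma actLeft_coact : A.bimod.actLeft ≫ A.coact =
    A.coinv.X ◁ A.coact ≫ (α_ A.coinv.X A.alg.X H).inv ≫ A.bimod.actLeft ▷ H := by
  have h : A.incl.hom ≫ A.coact = A.incl.hom ≫ A.trivialCoact :=
    equalizer.condition A.coact A.trivialCoact
  have h1 : (λ_ A.alg.X).inv ≫ η[H] ▷ A.alg.X ≫ A.lam = A.coact := by
    rw [lam, ← whisker_exchange_assoc]
    calc _ = A.coact ⊗≫ (η[H] ▷ A.alg.X ≫ (β_ H A.alg.X).hom) ▷ H ⊗≫
          A.alg.X ◁ μ[H] := by monoidal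
      _ = A.coact ⊗≫ A.alg.X ◁ (η[H] ▷ H ≫ μ[H]) := by
          rw [BraidedCategory.braiding_naturality_left, braiding_tensorUnit_left]
          monoidal
      _ = _ := by rw [MonObj.one_mul]; monoidal
  change (A.incl.hom ▷ A.alg.X ≫ μ[A.alg.X]) ≫ A.coact =
    A.coinv.X ◁ A.coact ≫ (α_ A.coinv.X A.alg.X H).inv ≫ (A.incl.hom ▷ A.alg.X ≫ μ[A.alg.X]) ▷ H
  calc _ = (A.incl.hom ≫ A.coact) ▷ A.alg.X ⊗≫ A.alg.X ◁ A.lam ⊗≫ μ[A.alg.X] ▷ H := by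
        rw [Category.assoc, mul_coact]; monoidal
    _ = A.incl.hom ▷ A.alg.X ⊗≫ A.alg.X ◁ ((λ_ A.alg.X).inv ≫ η[H] ▷ A.alg.X ≫ A.lam) ⊗≫
          μ[A.alg.X] ▷ H := by
        rw [h, trivialCoact]; monoidal
    _ = (A.incl.hom ▷ A.alg.X ≫ A.alg.X ◁ A.coact) ⊗≫ μ[A.alg.X] ▷ H := by
        rw [h1]; monoidal
    _ = _ := by rw [← whisker_exchange]; monoidal

variable [HasCoequalizers V]

/-- The canonical morphism `can : A ⊗_{A^H} A ⟶ A ⊗ H`, induced by `(m_A ⊗ H) (A ⊗ α_A)`. -/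
def can : relTensor (RightMod.restrict A.incl (RightMod.regular A.alg)) A.bimod ⟶ A.alg.X ⊗ H :=
  relTensor.desc _ A.bimod
    (A.alg.X ◁ A.coact ≫ (α_ A.alg.X A.alg.X H).inv ≫ μ[A.alg.X] ▷ H) (by
    have h : (A.incl.hom ▷ A.alg.X ≫ μ[A.alg.X]) ≫ A.coact = A.coinv.X ◁ A.coact ≫
      (α_ A.coinv.X A.alg.X H).inv ≫ (A.incl.hom ▷ A.alg.X ≫ μ[A.alg.X]) ▷ H := A.actLeft_coact
    change (A.alg.X ◁ A.incl.hom ≫ μ[A.alg.X]) ▷ A.alg.X ≫ A.alg.X ◁ A.coact ≫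
        (α_ A.alg.X A.alg.X H).inv ≫ μ[A.alg.X] ▷ H =
      (α_ A.alg.X A.coinv.X A.alg.X).hom ≫ A.alg.X ◁ (A.incl.hom ▷ A.alg.X ≫ μ[A.alg.X]) ≫
        A.alg.X ◁ A.coact ≫ (α_ A.alg.X A.alg.X H).inv ≫ μ[A.alg.X] ▷ H
    rw [← MonoidalCategory.whiskerLeft_comp_assoc, h, ← whisker_exchange_assoc]
    calc _ = (A.alg.X ⊗ A.coinv.X) ◁ A.coact ⊗≫ A.alg.X ◁ A.incl.hom ▷ (A.alg.X ⊗ H) ⊗≫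
          (μ[A.alg.X] ▷ A.alg.X ≫ μ[A.alg.X]) ▷ H := by monoidal
      _ = _ := by rw [MonObj.mul_assoc]; monoidal)

/-- `A` is `H`-Galois if the canonical morphism is an isomorphism. -/
def IsGalois : Prop := IsIso A.can

variable [∀ X : V, PreservesColimitsOfShape WalkingParallelPair (tensorRight X)]

/-- The functor from right `A^H`-modules to entwined modules which sends `X` to `X ⊗_{A^H} A`,
with action `X ⊗_{A^H} m_A` and coaction `X ⊗_{A^H} α_A`. -/
def Fbar : RightMod A.coinv ⥤ EntwinedModule A.entwining where
  obj X :=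
    { toRightMod := (tensorFunctor A.bimod).obj X
      coact := relTensor.coact X A.bimod A.coact A.actLeft_coact
      coact_counit := relTensor.coact_counit X A.bimod A.coact A.actLeft_coact A.coact_counit
      coact_comul := relTensor.coact_comul X A.bimod A.coact A.actLeft_coact A.coact_comul
      compat := relTensor.coact_compat X A.bimod A.coact A.actLeft_coact A.lam A.mul_coact }
  map f :=
    { hom := relTensor.map f A.bimod
      act_hom := ((tensorFunctor A.bimod).map f).act_hom
      coact_hom := relTensor.map_coact A.bimod A.coact A.actLeft_coact f }
  map_id X := EntwinedModule.Hom.ext (congrArg RightMod.Hom.hom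
    ((tensorFunctor A.bimod).map_id X))
  map_comp f g := EntwinedModule.Hom.ext (congrArg RightMod.Hom.hom
    ((tensorFunctor A.bimod).map_comp f g))

end ComoduleAlgebra

end BraidedGalois

end

/-! Write B for A^H. `Fbar` followed by `forget`, the functor that drops the coaction, is - ⊗_B A.
In the other direction M ↦ M^H is right adjoint to `Fbar`: a morphism out of X ⊗_B A is determined
by its values on the x ⊗ 1, and these are coinvariant. The two sides are compared by the canonical
morphisms can_N : N ⊗_B A ⟶ N ⊗ H, n ⊗ a ↦ n a_0 ⊗ a_1, defined for every right A-module N; the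
morphism `can` is the case N = A.

(i) ⇒ (ii). The functor `forget` is conservative, and it preserves equalizers because H is flat, so
both properties pass to - ⊗_B A = `Fbar` ⋙ `forget`. Since the coinvariants of the cofree module N ⊗
H are N ⊗ e_H, an isomorphism `Fbar` X ≅ N ⊗ H factors through can_N. This gives can_N a section,
and full faithfulness makes the section two-sided (`isIso_canHom`).

(ii) ⇒ (i). If `can` is invertible, so is every can_N, with inverse n ⊗ h ↦ n · can⁻¹(1 ⊗ h)
(`isIso_canMap`). For an entwined module M with coaction ν, M^H is the equalizer of ν and M ⊗ e_H.
Flatness keeps this an equalizer after - ⊗_B A, and the canonical isomorphisms turn the pair into ν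
⊗ H and M ⊗ δ, whose equalizer is ν itself. Hence the counit M^H ⊗_B A ⟶ M is invertible
(`isIso_counitLin`). A triangle identity then makes `Fbar` of the unit invertible, and
conservativity makes the unit invertible (`isEquivalence_Fbar`). -/

noncomputable section

namespace BraidedGalois

section

variable {V : Type u} [Category.{v} V] [MonoidalCategory V]

/-! ### Right modules: isomorphisms and equalizers come from the underlying category. -/

namespace RightMod

variable {A : Mon V} {M N : RightMod A}

lemma hom_ext {f g : M ⟶ N} (h : f.hom = g.hom) : f = g := Hom.ext h

@[simp]
lemma comp_hom {P : RightMod A} (f : M ⟶ N) (g : N ⟶ P) : (f ≫ g).hom = f.hom ≫ g.hom := rfl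

@[simp]
lemma id_hom (M : RightMod A) : Hom.hom (𝟙 M) = 𝟙 M.X := rfl

lemma isIso_hom (f : M ⟶ N) [IsIso f] : IsIso f.hom :=
  ⟨(inv f).hom, by rw [← comp_hom, IsIso.hom_inv_id, id_hom],
    by rw [← comp_hom, IsIso.inv_hom_id, id_hom]⟩

lemma isIso_of_isIso_hom (f : M ⟶ N) [IsIso f.hom] : IsIso f :=
  ⟨⟨inv f.hom, by
      rw [← cancel_epi (f.hom ▷ A.X), ← reassoc_of% f.act_hom]
      simp [← comp_whiskerRight_assoc]⟩,
    hom_ext (IsIso.hom_inv_id f.hom), hom_ext (IsIso.inv_hom_id f.hom)⟩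

section Equalizers

variable [HasEqualizers V] (f g : M ⟶ N)

/-- The action on the equalizer of two morphisms of right modules. -/
def equalizerAct : equalizer f.hom g.hom ⊗ A.X ⟶ equalizer f.hom g.hom :=
  equalizer.lift (equalizer.ι f.hom g.hom ▷ A.X ≫ M.act) (by
    rw [Category.assoc, Category.assoc, f.act_hom, g.act_hom, ← comp_whiskerRight_assoc,
      equalizer.condition, comp_whiskerRight_assoc])

lemma equalizerAct_ι : equalizerAct f g ≫ equalizer.ι f.hom g.hom =
    equalizer.ι f.hom g.hom ▷ A.X ≫ M.act :=
  equalizer.lift_ι _ _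

/-- The equalizer of two morphisms of right modules, formed in the underlying category. -/
def equalizerObj : RightMod A where
  X := equalizer f.hom g.hom
  act := equalizerAct f g
  act_one := by
    apply equalizer.hom_ext
    rw [Category.assoc, equalizerAct_ι, whisker_exchange_assoc, M.act_one,
      rightUnitor_naturality]
  act_mul := by
    apply equalizer.hom_ext
    simp only [Category.assoc, equalizerAct_ι]
    rw [whisker_exchange_assoc, M.act_mul, ← comp_whiskerRight_assoc, equalizerAct_ι]
    simp

/-- The inclusion of the equalizer of two morphisms of right modules. -/
def equalizerι : equalizerObj f g ⟶ M where
  hom := equalizer.ι f.hom g.hom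
  act_hom := equalizer.lift_ι _ _

lemma mono_equalizerι : Mono (equalizerι f g).hom := equalizer.ι_mono

lemma equalizerι_condition : equalizerι f g ≫ f = equalizerι f g ≫ g :=
  hom_ext (equalizer.condition f.hom g.hom)

/-- The universal property of the equalizer of two morphisms of right modules. -/
def equalizerLift {P : RightMod A} (k : P ⟶ M) (h : k.hom ≫ f.hom = k.hom ≫ g.hom) :
    P ⟶ equalizerObj f g where
  hom := equalizer.lift k.hom h
  act_hom := by
    apply equalizer.hom_ext
    simp only [equalizerObj, Category.assoc, equalizer.lift_ι, equalizerAct_ι]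
    rw [← comp_whiskerRight_assoc, equalizer.lift_ι, k.act_hom]

@[simp]
lemma equalizerLift_ι {P : RightMod A} (k : P ⟶ M) (h : k.hom ≫ f.hom = k.hom ≫ g.hom) :
    equalizerLift f g k h ≫ equalizerι f g = k :=
  hom_ext (equalizer.lift_ι _ _)

/-- The equalizer formed in the underlying category is an equalizer of right modules. -/
def isLimitEqualizer : IsLimit (Fork.ofι (equalizerι f g) (equalizerι_condition f g)) :=
  Fork.IsLimit.mk _
    (fun s => equalizerLift f g s.ι (congrArg Hom.hom s.condition))
    (fun _ => equalizerLift_ι f g _ _)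
    (fun _ _ hm => hom_ext (equalizer.hom_ext
      (congrArg Hom.hom (hm.trans (equalizerLift_ι f g _ _).symm))))

end Equalizers

end RightMod

/-! ### Tensoring equalizers with a flat object. -/

namespace FlatObj

variable [HasEqualizers V] {C X Y : V}

/-- If `C` is flat, then `- ⊗ C` preserves the equalizer of two morphisms. -/
def isLimit (hC : FlatObj C) (f g : X ⟶ Y) :
    IsLimit (Fork.ofι (equalizer.ι f g ▷ C)
      (show equalizer.ι f g ▷ C ≫ f ▷ C = equalizer.ι f g ▷ C ≫ g ▷ C by
        rw [← comp_whiskerRight, equalizer.condition, comp_whiskerRight])) :=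
  have : PreservesLimitsOfShape WalkingParallelPair (tensorRight C) := hC
  isLimitForkMapOfIsLimit (tensorRight C) (equalizer.condition f g) (equalizerIsEqualizer f g)

lemma mono_ι_whiskerRight (hC : FlatObj C) (f g : X ⟶ Y) :
    Mono (equalizer.ι f g ▷ C) :=
  mono_of_isLimit_fork (hC.isLimit f g)

/-- Flatness is applied twice, once per tensor factor. Coassociativity of the coaction on an
equalizer is tested after composing with this monomorphism. -/
lemma mono_ι_whiskerRight_tensor (hC : FlatObj C)
    (f g : X ⟶ Y) : Mono (equalizer.ι f g ▷ (C ⊗ C)) := by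
  have : PreservesLimitsOfShape WalkingParallelPair (tensorRight C) := hC
  have : Mono (equalizer.ι f g ▷ C ▷ C) := mono_of_isLimit_fork
    (isLimitForkMapOfIsLimit (tensorRight C) _ (hC.isLimit f g))
  rw [whiskerRight_tensor]
  infer_instance

end FlatObj

/-! ### Entwined modules: the forgetful functor and cofree objects. -/

namespace EntwinedModule

variable {C : V} [ComonObj C] {A : Mon V} {E : Entwining C A} {M N : EntwinedModule E}

lemma hom_ext {f g : M ⟶ N} (h : f.hom = g.hom) : f = g := Hom.ext h

@[simp]
lemma comp_hom {P : EntwinedModule E} (f : M ⟶ N) (g : N ⟶ P) :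
    (f ≫ g).hom = f.hom ≫ g.hom := rfl

@[simp]
lemma id_hom (M : EntwinedModule E) : Hom.hom (𝟙 M) = 𝟙 M.X := rfl

lemma isIso_hom (f : M ⟶ N) [IsIso f] : IsIso f.hom :=
  ⟨(inv f).hom, by rw [← comp_hom, IsIso.hom_inv_id, id_hom],
    by rw [← comp_hom, IsIso.inv_hom_id, id_hom]⟩

variable (E) in
/-- The functor from entwined modules to right modules which forgets the coaction. -/
def forget : EntwinedModule E ⥤ RightMod A where
  obj M := M.toRightMod
  map f := ⟨f.hom, f.act_hom⟩

lemma isIso_of_isIso_hom (f : M ⟶ N) [IsIso f.hom] : IsIso f := by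
  have : IsIso (RightMod.Hom.hom ((forget E).map f)) := inferInstanceAs (IsIso f.hom)
  have : IsIso ((forget E).map f) := RightMod.isIso_of_isIso_hom _
  refine ⟨⟨inv f.hom, ?_, ?_⟩,
    hom_ext (IsIso.hom_inv_id f.hom), hom_ext (IsIso.inv_hom_id f.hom)⟩
  · rw [← cancel_epi (f.hom ▷ A.X), ← reassoc_of% f.act_hom]
    simp [← comp_whiskerRight_assoc]
  · rw [← cancel_epi f.hom, ← reassoc_of% f.coact_hom, ← comp_whiskerRight]
    simp

/-- This supplies conservativity of - ⊗_{A^H} A once `Fbar` is known to be an equivalence. -/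
instance : (forget E).ReflectsIsomorphisms where
  reflects f _ := by
    have : IsIso f.hom := RightMod.isIso_hom ((forget E).map f)
    exact isIso_of_isIso_hom f

section Cofree

variable (E)

/-- The action of `A` on `N ⊗ C`, twisted by the entwining structure. -/
def tensorAct (N : RightMod A) : (N.X ⊗ C) ⊗ A.X ⟶ N.X ⊗ C :=
  (α_ N.X C A.X).hom ≫ N.X ◁ E.lam ≫ (α_ N.X A.X C).inv ≫ N.act ▷ C

/-- The right `A`-module `N ⊗ C`, with action twisted by the entwining structure. -/
def tensorRightMod (N : RightMod A) : RightMod A where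
  X := N.X ⊗ C
  act := tensorAct E N
  act_one := by
    rw [tensorAct]
    calc _ = 𝟙 _ ⊗≫ N.X ◁ (C ◁ η[A.X] ≫ E.lam) ⊗≫ N.act ▷ C := by monoidal
      _ = 𝟙 _ ⊗≫ (N.X ◁ η[A.X] ≫ N.act) ▷ C := by rw [E.one_lam]; monoidal
      _ = _ := by rw [N.act_one]; monoidal
  act_mul := by
    rw [tensorAct]
    calc _ = 𝟙 _ ⊗≫ N.X ◁ (C ◁ μ[A.X] ≫ E.lam) ⊗≫ N.act ▷ C := by monoidal
      _ = 𝟙 _ ⊗≫ N.X ◁ (E.lam ▷ A.X) ⊗≫ (N.X ⊗ A.X) ◁ E.lam ⊗≫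
          (N.X ◁ μ[A.X] ≫ N.act) ▷ C := by rw [E.mul_lam]; monoidal
      _ = 𝟙 _ ⊗≫ N.X ◁ (E.lam ▷ A.X) ⊗≫ ((N.X ⊗ A.X) ◁ E.lam ≫
          N.act ▷ (A.X ⊗ C)) ⊗≫ N.act ▷ C := by rw [N.act_mul]; monoidal
      _ = _ := by rw [whisker_exchange]; monoidal

/-- The cofree entwined module on a right module. -/
def cofree (N : RightMod A) : EntwinedModule E where
  toRightMod := tensorRightMod E N
  coact := N.X ◁ Δ[C] ≫ (α_ N.X C C).inv
  coact_counit := by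
    change (N.X ◁ Δ[C] ≫ (α_ N.X C C).inv) ≫ (N.X ⊗ C) ◁ ε[C] = (ρ_ (N.X ⊗ C)).inv
    calc _ = N.X ◁ (Δ[C] ≫ C ◁ ε[C]) ⊗≫ 𝟙 _ := by monoidal
      _ = _ := by rw [ComonObj.comul_counit]; monoidal
  coact_comul := by
    change (N.X ◁ Δ[C] ≫ (α_ N.X C C).inv) ≫ (N.X ⊗ C) ◁ Δ[C] =
      (N.X ◁ Δ[C] ≫ (α_ N.X C C).inv) ≫ (N.X ◁ Δ[C] ≫ (α_ N.X C C).inv) ▷ C ≫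
        (α_ (N.X ⊗ C) C C).hom
    calc _ = N.X ◁ (Δ[C] ≫ C ◁ Δ[C]) ⊗≫ 𝟙 _ := by monoidal
      _ = _ := by rw [ComonObj.comul_assoc]; monoidal
  compat := by
    change tensorAct E N ≫ N.X ◁ Δ[C] ≫ (α_ N.X C C).inv =
      (N.X ◁ Δ[C] ≫ (α_ N.X C C).inv) ▷ A.X ≫ (α_ (N.X ⊗ C) C A.X).hom ≫
        (N.X ⊗ C) ◁ E.lam ≫ (α_ (N.X ⊗ C) A.X C).inv ≫ tensorAct E N ▷ C
    rw [tensorAct]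
    calc _ = 𝟙 _ ⊗≫ N.X ◁ E.lam ⊗≫ (N.act ▷ C ≫ N.X ◁ Δ[C]) ⊗≫ 𝟙 _ := by monoidal
      _ = 𝟙 _ ⊗≫ N.X ◁ (E.lam ≫ A.X ◁ Δ[C]) ⊗≫ N.act ▷ (C ⊗ C) ⊗≫ 𝟙 _ := by
          rw [← whisker_exchange]; monoidal
      _ = _ := by rw [E.lam_comul]; monoidal

end Cofree

/-! ### Equalizers of entwined modules over a flat coalgebra. -/

section Equalizers

variable [HasEqualizers V] (hC : FlatObj C) (f g : M ⟶ N)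

/-- The coaction on the equalizer of two morphisms of entwined modules. -/
def equalizerCoact : equalizer f.hom g.hom ⟶ equalizer f.hom g.hom ⊗ C :=
  Fork.IsLimit.lift (hC.isLimit f.hom g.hom) (equalizer.ι f.hom g.hom ≫ M.coact) (by
    rw [Category.assoc, Category.assoc, f.coact_hom, g.coact_hom, equalizer.condition_assoc])

lemma equalizerCoact_ι : equalizerCoact hC f g ≫ equalizer.ι f.hom g.hom ▷ C =
    equalizer.ι f.hom g.hom ≫ M.coact :=
  Fork.IsLimit.lift_ι' (hC.isLimit f.hom g.hom) _ _

/-- The equalizer of two morphisms of entwined modules, formed in the underlying category. -/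
def equalizerObj : EntwinedModule E where
  toRightMod := RightMod.equalizerObj ((forget E).map f) ((forget E).map g)
  coact := equalizerCoact hC f g
  coact_counit := by
    change equalizerCoact hC f g ≫ equalizer f.hom g.hom ◁ ε[C] = (ρ_ (equalizer f.hom g.hom)).inv
    have : Mono (equalizer.ι f.hom g.hom ▷ 𝟙_ V) := by
      rw [whiskerRight_id]; infer_instance
    rw [← cancel_mono (equalizer.ι f.hom g.hom ▷ 𝟙_ V), Category.assoc, whisker_exchange,
      reassoc_of% equalizerCoact_ι, M.coact_counit, rightUnitor_inv_naturality]
  coact_comul := by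
    change equalizerCoact hC f g ≫ equalizer f.hom g.hom ◁ Δ[C] =
      equalizerCoact hC f g ≫ equalizerCoact hC f g ▷ C ≫ (α_ (equalizer f.hom g.hom) C C).hom
    have := hC.mono_ι_whiskerRight_tensor f.hom g.hom
    rw [← cancel_mono (equalizer.ι f.hom g.hom ▷ (C ⊗ C)), Category.assoc, whisker_exchange,
      reassoc_of% equalizerCoact_ι, M.coact_comul, Category.assoc, Category.assoc,
      ← associator_naturality_left, ← comp_whiskerRight_assoc, equalizerCoact_ι,
      comp_whiskerRight_assoc, reassoc_of% equalizerCoact_ι]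
  compat := by
    let a : equalizer f.hom g.hom ⊗ A.X ⟶ equalizer f.hom g.hom :=
      RightMod.equalizerAct ((forget E).map f) ((forget E).map g)
    have hι : a ≫ equalizer.ι f.hom g.hom = equalizer.ι f.hom g.hom ▷ A.X ≫ M.act :=
      RightMod.equalizerAct_ι ((forget E).map f) ((forget E).map g)
    -- The compatibility is inherited from `M`, since it can be checked after the monomorphism ι ⊗
    -- C.
    have := hC.mono_ι_whiskerRight f.hom g.hom
    change a ≫ equalizerCoact hC f g = equalizerCoact hC f g ▷ A.X ≫
      (α_ (equalizer f.hom g.hom) C A.X).hom ≫ equalizer f.hom g.hom ◁ E.lam ≫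
        (α_ (equalizer f.hom g.hom) A.X C).inv ≫ a ▷ C
    rw [← cancel_mono (equalizer.ι f.hom g.hom ▷ C)]
    simp only [Category.assoc]
    rw [equalizerCoact_ι, reassoc_of% hι, M.compat, ← comp_whiskerRight, hι, comp_whiskerRight,
      ← comp_whiskerRight_assoc, ← equalizerCoact_ι hC f g, comp_whiskerRight_assoc]
    calc _ = equalizerCoact hC f g ▷ A.X ⊗≫ (equalizer.ι f.hom g.hom ▷ (C ⊗ A.X) ≫
          M.X ◁ E.lam) ⊗≫ M.act ▷ C := by monoidal
      _ = _ := by rw [← whisker_exchange]; monoidal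

/-- The inclusion of the equalizer of two morphisms of entwined modules. -/
def equalizerι : equalizerObj hC f g ⟶ M where
  hom := equalizer.ι f.hom g.hom
  act_hom := equalizer.lift_ι _ _
  coact_hom := equalizerCoact_ι hC f g

lemma equalizerι_condition : equalizerι hC f g ≫ f = equalizerι hC f g ≫ g :=
  hom_ext (equalizer.condition f.hom g.hom)

/-- The universal property of the equalizer of two morphisms of entwined modules. -/
def equalizerLift {P : EntwinedModule E} (k : P ⟶ M) (h : k ≫ f = k ≫ g) :
    P ⟶ equalizerObj hC f g where
  hom := equalizer.lift k.hom (congrArg Hom.hom h)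
  act_hom := (RightMod.equalizerLift ((forget E).map f) ((forget E).map g) ((forget E).map k)
    (congrArg Hom.hom h)).act_hom
  coact_hom := by
    let l : P.X ⟶ equalizer f.hom g.hom := equalizer.lift k.hom (congrArg Hom.hom h)
    have hl : l ≫ equalizer.ι f.hom g.hom = k.hom := equalizer.lift_ι _ _
    have := hC.mono_ι_whiskerRight f.hom g.hom
    change P.coact ≫ l ▷ C = l ≫ equalizerCoact hC f g
    rw [← cancel_mono (equalizer.ι f.hom g.hom ▷ C), Category.assoc, ← comp_whiskerRight,
      hl, k.coact_hom, Category.assoc, equalizerCoact_ι, reassoc_of% hl]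

/-- The equalizer formed in the underlying category is an equalizer of entwined modules. -/
def isLimitEqualizer :
    IsLimit (Fork.ofι (equalizerι hC f g) (equalizerι_condition hC f g)) :=
  Fork.IsLimit.mk _
    (fun s => equalizerLift hC f g s.ι s.condition)
    (fun _ => hom_ext (equalizer.lift_ι _ _))
    (fun _ _ hm => hom_ext (equalizer.hom_ext
      ((congrArg Hom.hom hm).trans (equalizer.lift_ι _ _).symm)))

/-- If `C` is flat, then equalizers of entwined modules are formed in right modules. -/
lemma preservesLimitsOfShape_forget (hC : FlatObj C) :
    PreservesLimitsOfShape WalkingParallelPair (forget E) where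
  preservesLimit {K} := by
    -- Up to isomorphism every diagram of this shape is a parallel pair, and `forget` carries the
    -- equalizer fork of entwined modules to the one already known for right modules.
    have h : PreservesLimit (parallelPair (K.map WalkingParallelPairHom.left)
        (K.map WalkingParallelPairHom.right)) (forget E) :=
      preservesLimit_of_preserves_limit_cone (isLimitEqualizer hC _ _)
        ((isLimitMapConeForkEquiv (forget E) (equalizerι_condition hC _ _)).symm
          (RightMod.isLimitEqualizer _ _))
    exact preservesLimit_of_iso_diagram (forget E) (diagramIsoParallelPair K).symm

end Equalizers

end EntwinedModule

end

/-! ### The diagonal action on N ⊗ H, and coinvariants. -/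

section

variable {V : Type u} [Category.{v} V] [MonoidalCategory V]

namespace RightMod

/-- Restriction of scalars on morphisms of right modules. -/
def restrictMap {B A : Mon V} (f : B ⟶ A) {M N : RightMod A} (g : M ⟶ N) :
    restrict f M ⟶ restrict f N where
  hom := g.hom
  act_hom := by
    change (M.X ◁ f.hom ≫ M.act) ≫ g.hom = g.hom ▷ B.X ≫ N.X ◁ f.hom ≫ N.act
    rw [Category.assoc, g.act_hom, whisker_exchange_assoc]

end RightMod

namespace EntwinedModule

variable {C : V} [ComonObj C] {A : Mon V} {E : Entwining C A}

/-- The coaction of an entwined module `M`, as a morphism of right modules `M ⟶ M ⊗ C`. -/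
def coactHom (M : EntwinedModule E) : M.toRightMod ⟶ tensorRightMod E M.toRightMod where
  hom := M.coact
  act_hom := M.compat

variable (E)

/-- Functoriality of the right module `N ⊗ C` in `N`. -/
def tensorRightModMap {M N : RightMod A} (f : M ⟶ N) :
    tensorRightMod E M ⟶ tensorRightMod E N where
  hom := f.hom ▷ C
  act_hom := by
    change tensorAct E M ≫ f.hom ▷ C = f.hom ▷ C ▷ A.X ≫ tensorAct E N
    simp only [tensorAct, Category.assoc]
    rw [associator_naturality_left_assoc, ← whisker_exchange_assoc,
      associator_inv_naturality_left_assoc, ← comp_whiskerRight, f.act_hom, comp_whiskerRight]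

/-- The counit `N ⊗ C ⟶ N`, a morphism of right modules. -/
def tensorRightModCounit (N : RightMod A) : tensorRightMod E N ⟶ N where
  hom := N.X ◁ ε[C] ≫ (ρ_ N.X).hom
  act_hom := by
    change tensorAct E N ≫ N.X ◁ ε[C] ≫ (ρ_ N.X).hom =
      (N.X ◁ ε[C] ≫ (ρ_ N.X).hom) ▷ A.X ≫ N.act
    rw [tensorAct]
    calc _ = 𝟙 _ ⊗≫ N.X ◁ E.lam ⊗≫ (N.act ▷ C ≫ N.X ◁ ε[C]) ≫ (ρ_ N.X).hom := by monoidal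
      _ = 𝟙 _ ⊗≫ N.X ◁ (E.lam ≫ A.X ◁ ε[C]) ⊗≫ N.act := by
          rw [← whisker_exchange]; monoidal
      _ = _ := by rw [E.lam_counit]; monoidal

end EntwinedModule

variable [BraidedCategory V]

namespace ComoduleAlgebra

open EntwinedModule

variable {H : V} [BimonObj H] (A : ComoduleAlgebra H)

/-- Braiding past the unit object is trivial, and e_H is neutral for m_H. Thus the entwining
recovers the coaction when e_H is inserted, which is the source of the formula for the canonical
morphisms. -/
lemma one_lam : (λ_ A.alg.X).inv ≫ η[H] ▷ A.alg.X ≫ A.lam = A.coact := by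
  rw [lam, ← whisker_exchange_assoc]
  calc _ = A.coact ⊗≫ (η[H] ▷ A.alg.X ≫ (β_ H A.alg.X).hom) ▷ H ⊗≫
        A.alg.X ◁ μ[H] := by monoidal
    _ = A.coact ⊗≫ A.alg.X ◁ (η[H] ▷ H ≫ μ[H]) := by
        rw [BraidedCategory.braiding_naturality_left, braiding_tensorUnit_left]
        monoidal
    _ = _ := by rw [MonObj.one_mul]; monoidal

/-- The morphism `X ⊗ e_H : X ⟶ X ⊗ H`. -/
def tensorUnit (X : V) : X ⟶ X ⊗ H := (ρ_ X).inv ≫ X ◁ η[H]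

lemma tensorUnit_naturality {X Y : V} (f : X ⟶ Y) :
    tensorUnit X ≫ f ▷ H = f ≫ tensorUnit (H := H) Y := by
  rw [tensorUnit, tensorUnit, Category.assoc, whisker_exchange, rightUnitor_inv_naturality_assoc]

lemma tensorUnit_counit (X : V) :
    tensorUnit (H := H) X ≫ X ◁ ε[H] ≫ (ρ_ X).hom = 𝟙 X := by
  rw [tensorUnit, Category.assoc, ← MonoidalCategory.whiskerLeft_comp_assoc, BimonObj.one_counit]
  simp

/-- The unit e_H is grouplike. Consequently n ⊗ e_H is coinvariant in the cofree module N ⊗ H. -/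
lemma tensorUnit_comul (X : V) :
    tensorUnit X ≫ X ◁ Δ[H] ≫ (α_ X H H).inv = tensorUnit X ≫ tensorUnit (H := H) (X ⊗ H) := by
  rw [tensorUnit, Category.assoc, ← MonoidalCategory.whiskerLeft_comp_assoc, BimonObj.one_comul]
  rw [MonObj.tensorObj.one_def, tensorUnit, MonoidalCategory.tensorHom_def]
  monoidal

/-- The action of `A` on `N ⊗ e_H`. -/
lemma tensorUnit_act (N : RightMod A.alg) :
    tensorUnit N.X ▷ A.alg.X ≫ tensorAct A.entwining N =
      N.X ◁ A.coact ≫ (α_ N.X A.alg.X H).inv ≫ N.act ▷ H := by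
  change tensorUnit N.X ▷ A.alg.X ≫ (α_ N.X H A.alg.X).hom ≫ N.X ◁ A.lam ≫
    (α_ N.X A.alg.X H).inv ≫ N.act ▷ H = _
  rw [← one_lam, tensorUnit]
  monoidal

/-- For a right `A`-module `N`, the right `A`-module `N ⊗ H` with the diagonal action. -/
abbrev tensorH (N : RightMod A.alg) : RightMod A.alg := tensorRightMod A.entwining N

variable [HasEqualizers V]

lemma incl_coact : A.incl.hom ≫ A.coact = A.incl.hom ≫ tensorUnit A.alg.X :=
  equalizer.condition A.coact A.trivialCoact

/-- A right `A`-module, regarded as a right `A^H`-module. -/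
abbrev res (N : RightMod A.alg) : RightMod A.coinv := RightMod.restrict A.incl N

/-- The morphism `N ⊗ e_H : N ⟶ N ⊗ H` is right `A^H`-linear. -/
lemma act_tensorUnit (N : RightMod A.alg) : (N.X ◁ A.incl.hom ≫ N.act) ≫ tensorUnit N.X =
    tensorUnit N.X ▷ A.coinv.X ≫ (N.X ⊗ H) ◁ A.incl.hom ≫ tensorAct A.entwining N := by
  -- In elements, (n ⊗ 1) b = n b_0 ⊗ b_1, and this is n b ⊗ 1 because b is coinvariant.
  rw [← whisker_exchange_assoc, tensorUnit_act, ← MonoidalCategory.whiskerLeft_comp_assoc,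
    incl_coact, Category.assoc, ← tensorUnit_naturality, tensorUnit, tensorUnit]
  monoidal

/-- The morphism of right `A^H`-modules `N ⊗ e_H : N ⟶ N ⊗ H`. -/
def tensorUnitHom (N : RightMod A.alg) : A.res N ⟶ A.res (A.tensorH N) where
  hom := tensorUnit N.X
  act_hom := A.act_tensorUnit N

/-- The right `A^H`-module of coinvariants of an entwined module. -/
def coinvariants (M : EntwinedModule A.entwining) : RightMod A.coinv :=
  RightMod.equalizerObj (RightMod.restrictMap A.incl M.coactHom) (A.tensorUnitHom M.toRightMod)

/-- The inclusion of the coinvariants. -/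
def coinvariantsι (M : EntwinedModule A.entwining) : A.coinvariants M ⟶ A.res M.toRightMod :=
  RightMod.equalizerι _ _

/-- The inclusion of the coinvariants, as a morphism in `V`. -/
def coinvariantsιHom (M : EntwinedModule A.entwining) : (A.coinvariants M).X ⟶ M.X :=
  (A.coinvariantsι M).hom

lemma coinvariantsιHom_coact (M : EntwinedModule A.entwining) :
    A.coinvariantsιHom M ≫ M.coact = A.coinvariantsιHom M ≫ tensorUnit M.X :=
  congrArg RightMod.Hom.hom (RightMod.equalizerι_condition
    (RightMod.restrictMap A.incl M.coactHom) (A.tensorUnitHom M.toRightMod))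

lemma coinvariants_act (M : EntwinedModule A.entwining) :
    (A.coinvariants M).act ≫ A.coinvariantsιHom M =
      A.coinvariantsιHom M ▷ A.coinv.X ≫ M.X ◁ A.incl.hom ≫ M.act :=
  (A.coinvariantsι M).act_hom

/-- A morphism of right `A^H`-modules with values in the coinvariants. -/
def coinvariantsLift {X : RightMod A.coinv} (M : EntwinedModule A.entwining) (g : X.X ⟶ M.X)
    (hg : X.act ≫ g = g ▷ A.coinv.X ≫ M.X ◁ A.incl.hom ≫ M.act)
    (h : g ≫ M.coact = g ≫ tensorUnit M.X) : X ⟶ A.coinvariants M :=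
  RightMod.equalizerLift _ _ (⟨g, hg⟩ : X ⟶ A.res M.toRightMod) h

lemma coinvariantsLift_ι {X : RightMod A.coinv} (M : EntwinedModule A.entwining) (g : X.X ⟶ M.X)
    (hg : X.act ≫ g = g ▷ A.coinv.X ≫ M.X ◁ A.incl.hom ≫ M.act)
    (h : g ≫ M.coact = g ≫ tensorUnit M.X) :
    (A.coinvariantsLift M g hg h).hom ≫ A.coinvariantsιHom M = g :=
  equalizer.lift_ι _ _

/-! ### Induction along A^H ⟶ A and its universal property. -/

variable [HasCoequalizers V]
variable [∀ X : V, PreservesColimitsOfShape WalkingParallelPair (tensorRight X)]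

/-- The functor `- ⊗_{A^H} A`. -/
abbrev ind : RightMod A.coinv ⥤ RightMod A.alg := tensorFunctor A.bimod

/-- The canonical epimorphism `X ⊗ A ⟶ X ⊗_{A^H} A`. -/
def indπ (X : RightMod A.coinv) : X.X ⊗ A.alg.X ⟶ (A.ind.obj X).X :=
  relTensor.π X A.bimod

instance (X : RightMod A.coinv) : Epi (A.indπ X) :=
  inferInstanceAs (Epi (relTensor.π X A.bimod))

instance (X : RightMod A.coinv) (Z : V) : Epi (A.indπ X ▷ Z) :=
  relTensor.epi_π_whiskerRight X A.bimod Z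

lemma indπ_condition (X : RightMod A.coinv) : X.act ▷ A.alg.X ≫ A.indπ X =
    (α_ X.X A.coinv.X A.alg.X).hom ≫ X.X ◁ (A.incl.hom ▷ A.alg.X ≫ μ[A.alg.X]) ≫ A.indπ X :=
  relTensor.condition X A.bimod

lemma indπ_act (X : RightMod A.coinv) : A.indπ X ▷ A.alg.X ≫ (A.ind.obj X).act =
    (α_ X.X A.alg.X A.alg.X).hom ≫ X.X ◁ μ[A.alg.X] ≫ A.indπ X :=
  relTensor.π_act X A.bimod

/-- The coaction of `H` on `X ⊗_{A^H} A`. -/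
def indCoact (X : RightMod A.coinv) : (A.ind.obj X).X ⟶ (A.ind.obj X).X ⊗ H :=
  (A.Fbar.obj X).coact

lemma indπ_coact (X : RightMod A.coinv) : A.indπ X ≫ A.indCoact X =
    X.X ◁ A.coact ≫ (α_ X.X A.alg.X H).inv ≫ A.indπ X ▷ H :=
  relTensor.π_coact X A.bimod A.coact A.actLeft_coact

/-- The unit `X ⟶ X ⊗_{A^H} A`. -/
def indUnit (X : RightMod A.coinv) : X.X ⟶ (A.ind.obj X).X :=
  (ρ_ X.X).inv ≫ X.X ◁ η[A.alg.X] ≫ A.indπ X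

/-- In elements, (x ⊗ 1) a = x ⊗ a. An A-linear morphism out of the induced module is therefore
determined by its values on the x ⊗ 1. -/
lemma indUnit_whiskerRight_act (X : RightMod A.coinv) :
    A.indUnit X ▷ A.alg.X ≫ (A.ind.obj X).act = A.indπ X := by
  rw [indUnit, comp_whiskerRight, comp_whiskerRight, Category.assoc, Category.assoc, indπ_act]
  calc _ = 𝟙 _ ⊗≫ X.X ◁ (η[A.alg.X] ▷ A.alg.X ≫ μ[A.alg.X]) ⊗≫ A.indπ X := by monoidal
    _ = _ := by rw [MonObj.one_mul]; monoidal

/-- The coaction of A is unital, so x ⊗ 1 is coinvariant. -/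
lemma indUnit_coact (X : RightMod A.coinv) :
    A.indUnit X ≫ A.indCoact X = A.indUnit X ≫ tensorUnit (A.ind.obj X).X := by
  have h : η[A.alg.X] ≫ A.coact = η[A.alg.X] ≫ tensorUnit A.alg.X :=
    (IsMonHom.one_hom A.coact).trans (IsMonHom.one_hom A.trivialCoact).symm
  rw [← tensorUnit_naturality, indUnit]
  simp only [Category.assoc, comp_whiskerRight]
  rw [indπ_coact, ← MonoidalCategory.whiskerLeft_comp_assoc, h, ← tensorUnit_naturality,
    tensorUnit, tensorUnit]
  monoidal

/-- The unit `X ⟶ X ⊗_{A^H} A` is right `A^H`-linear. -/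
lemma act_indUnit (X : RightMod A.coinv) : X.act ≫ A.indUnit X =
    A.indUnit X ▷ A.coinv.X ≫ (A.ind.obj X).X ◁ A.incl.hom ≫ (A.ind.obj X).act := by
  rw [← whisker_exchange_assoc, indUnit_whiskerRight_act, indUnit]
  calc _ = 𝟙 _ ⊗≫ (X.act ▷ (𝟙_ V) ≫ X.X ◁ η[A.alg.X]) ≫ A.indπ X := by monoidal
    _ = 𝟙 _ ⊗≫ (X.X ⊗ A.coinv.X) ◁ η[A.alg.X] ⊗≫ (X.act ▷ A.alg.X ≫ A.indπ X) := by
        rw [← whisker_exchange]; monoidal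
    _ = 𝟙 _ ⊗≫ X.X ◁ (A.coinv.X ◁ η[A.alg.X] ≫ A.incl.hom ▷ A.alg.X) ⊗≫
        X.X ◁ μ[A.alg.X] ≫ A.indπ X := by rw [indπ_condition]; monoidal
    _ = 𝟙 _ ⊗≫ X.X ◁ A.incl.hom ⊗≫ X.X ◁ (A.alg.X ◁ η[A.alg.X] ≫ μ[A.alg.X]) ⊗≫
        A.indπ X := by rw [whisker_exchange]; monoidal
    _ = _ := by rw [MonObj.mul_one]; monoidal

lemma indUnit_map {X Y : RightMod A.coinv} (f : X ⟶ Y) :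
    A.indUnit X ≫ (A.ind.map f).hom = f.hom ≫ A.indUnit Y := by
  have h : A.indπ X ≫ (A.ind.map f).hom = f.hom ▷ A.alg.X ≫ A.indπ Y := relTensor.π_map f A.bimod
  rw [indUnit, Category.assoc, Category.assoc, h, whisker_exchange_assoc, indUnit,
    rightUnitor_inv_naturality_assoc]

lemma indπ_hom {X : RightMod A.coinv} {N : RightMod A.alg} (f : A.ind.obj X ⟶ N) :
    A.indπ X ≫ f.hom = (A.indUnit X ≫ f.hom) ▷ A.alg.X ≫ N.act := by
  rw [← indUnit_whiskerRight_act, comp_whiskerRight, Category.assoc, Category.assoc, f.act_hom]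

/-- Morphisms of right modules out of `X ⊗_{A^H} A` are determined on `X`. -/
lemma ind_hom_ext {X : RightMod A.coinv} {N : RightMod A.alg} {f g : A.ind.obj X ⟶ N}
    (h : A.indUnit X ≫ f.hom = A.indUnit X ≫ g.hom) : f = g := by
  apply RightMod.hom_ext
  rw [← cancel_epi (A.indπ X), indπ_hom, indπ_hom, h]

/-- Morphisms of entwined modules out of `X ⊗_{A^H} A` are determined on `X`. -/
lemma Fbar_hom_ext {X : RightMod A.coinv} {M : EntwinedModule A.entwining}
    {f g : A.Fbar.obj X ⟶ M}
    (h : A.indUnit X ≫ ((forget A.entwining).map f).hom =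
      A.indUnit X ≫ ((forget A.entwining).map g).hom) : f = g :=
  EntwinedModule.hom_ext (congrArg RightMod.Hom.hom
    (A.ind_hom_ext (f := (forget A.entwining).map f) (g := (forget A.entwining).map g) h))

section Desc

variable {X : RightMod A.coinv} {N : RightMod A.alg} (g : X.X ⟶ N.X)
  (hg : X.act ≫ g = g ▷ A.coinv.X ≫ N.X ◁ A.incl.hom ≫ N.act)

/-- The morphism `X ⊗_{A^H} A ⟶ N` induced by an `A^H`-linear morphism `X ⟶ N`. -/
def indDescHom : (A.ind.obj X).X ⟶ N.X :=
  relTensor.desc X A.bimod (g ▷ A.alg.X ≫ N.act) (by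
    change X.act ▷ A.alg.X ≫ g ▷ A.alg.X ≫ N.act = (α_ X.X A.coinv.X A.alg.X).hom ≫
      X.X ◁ (A.incl.hom ▷ A.alg.X ≫ μ[A.alg.X]) ≫ g ▷ A.alg.X ≫ N.act
    rw [← comp_whiskerRight_assoc, hg, whisker_exchange_assoc, MonoidalCategory.whiskerLeft_comp,
      Category.assoc, N.act_mul]
    monoidal)

lemma indπ_indDescHom : A.indπ X ≫ A.indDescHom g hg = g ▷ A.alg.X ≫ N.act :=
  relTensor.π_desc _ _ _ _

lemma indUnit_indDescHom : A.indUnit X ≫ A.indDescHom g hg = g := by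
  rw [indUnit, Category.assoc, Category.assoc, indπ_indDescHom, whisker_exchange_assoc, N.act_one]
  simp

/-- The morphism of right `A`-modules `X ⊗_{A^H} A ⟶ N` induced by an `A^H`-linear morphism
`X ⟶ N`. -/
def indDesc : A.ind.obj X ⟶ N where
  hom := A.indDescHom g hg
  act_hom := by
    rw [← cancel_epi (A.indπ X ▷ A.alg.X), reassoc_of% indπ_act, indπ_indDescHom,
      ← comp_whiskerRight_assoc, indπ_indDescHom, whisker_exchange_assoc, N.act_mul]
    simp

lemma indUnit_indDesc : A.indUnit X ≫ (A.indDesc g hg).hom = g :=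
  A.indUnit_indDescHom g hg

end Desc

section FbarDesc

variable {X : RightMod A.coinv} {M : EntwinedModule A.entwining} (g : X.X ⟶ M.X)
  (hg : X.act ≫ g = g ▷ A.coinv.X ≫ M.X ◁ A.incl.hom ≫ M.act)

/-- Compatibility of action and coaction gives ν(g(x) a) = (g(x) ⊗ 1) a, the twisted action on M ⊗
H, and `tensorUnit_act` evaluates this as g(x) a_0 ⊗ a_1. -/
lemma indDescHom_coact (h : g ≫ M.coact = g ≫ tensorUnit M.X) :
    A.indCoact X ≫ A.indDescHom (N := M.toRightMod) g hg ▷ H =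
      A.indDescHom (N := M.toRightMod) g hg ≫ M.coact := by
  rw [← cancel_epi (A.indπ X), reassoc_of% indπ_coact, ← comp_whiskerRight, indπ_indDescHom,
    reassoc_of% indπ_indDescHom, M.compat, ← comp_whiskerRight_assoc, h]
  have h2 := A.tensorUnit_act M.toRightMod
  rw [tensorAct] at h2
  rw [comp_whiskerRight_assoc, h2, ← whisker_exchange_assoc]
  simp

/-- The morphism of entwined modules `X ⊗_{A^H} A ⟶ M` induced by an `A^H`-linear morphism
`X ⟶ M` with values in the coinvariants. -/
def FbarDesc (h : g ≫ M.coact = g ≫ tensorUnit M.X) : A.Fbar.obj X ⟶ M where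
  hom := (A.indDesc (N := M.toRightMod) g hg).hom
  act_hom := (A.indDesc (N := M.toRightMod) g hg).act_hom
  coact_hom := A.indDescHom_coact g hg h

lemma indUnit_FbarDesc (h : g ≫ M.coact = g ≫ tensorUnit M.X) :
    A.indUnit X ≫ ((forget A.entwining).map (A.FbarDesc g hg h)).hom = g :=
  A.indUnit_indDesc (N := M.toRightMod) g hg

end FbarDesc

end ComoduleAlgebra

end

/-! ### The canonical morphisms N ⊗_{A^H} A ⟶ N ⊗ H. -/

section

variable {V : Type u} [Category.{v} V] [MonoidalCategory V] [BraidedCategory V]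

namespace ComoduleAlgebra

open EntwinedModule

variable {H : V} [BimonObj H] (A : ComoduleAlgebra H)

/-- The coaction is split by the counit of H, which is A-linear for the twisted action. -/
lemma mono_coactHom (M : EntwinedModule A.entwining) : Mono M.coactHom := by
  have h : M.coactHom ≫ tensorRightModCounit A.entwining M.toRightMod = 𝟙 M.toRightMod := by
    apply RightMod.hom_ext
    change M.coact ≫ M.X ◁ ε[H] ≫ (ρ_ M.X).hom = 𝟙 M.X
    rw [reassoc_of% M.coact_counit, Iso.inv_hom_id]
  exact mono_of_mono_fac h

/-- Coinvariants of the cofree comodule `N ⊗ H` are of the form `n ⊗ e_H`. -/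
lemma comp_counit_tensorUnit {X N : V} (p : X ⟶ N ⊗ H)
    (hp : p ≫ N ◁ Δ[H] ≫ (α_ N H H).inv = p ≫ tensorUnit (N ⊗ H)) :
    (p ≫ N ◁ ε[H] ≫ (ρ_ N).hom) ≫ tensorUnit N = p := by
  -- Apply ε_H to the first of the two H-factors in `hp`.
  rw [Category.assoc, ← tensorUnit_naturality, ← Category.assoc, ← hp]
  calc _ = p ≫ N ◁ (Δ[H] ≫ ε[H] ▷ H) ⊗≫ 𝟙 _ := by monoidal
    _ = _ := by rw [ComonObj.counit_comul]; monoidal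

variable [HasEqualizers V] [HasCoequalizers V]

section Canonical

variable [∀ X : V, PreservesColimitsOfShape WalkingParallelPair (tensorRight X)]

/-- The canonical morphism of entwined modules `N ⊗_{A^H} A ⟶ N ⊗ H`. -/
def canHom (N : RightMod A.alg) : A.Fbar.obj (A.res N) ⟶ cofree A.entwining N :=
  A.FbarDesc (X := A.res N) (M := cofree A.entwining N) (tensorUnit N.X) (A.act_tensorUnit N)
    (tensorUnit_comul N.X)

/-- The canonical morphism `N ⊗_{A^H} A ⟶ N ⊗ H` in the underlying category. -/
def canMap (N : RightMod A.alg) : (A.ind.obj (A.res N)).X ⟶ N.X ⊗ H := (A.canHom N).hom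

/-- The canonical morphism `N ⊗_{A^H} A ⟶ N ⊗ H` of right modules. -/
def canLin (N : RightMod A.alg) : A.ind.obj (A.res N) ⟶ A.tensorH N :=
  (forget A.entwining).map (A.canHom N)

/-- The morphism of right modules `N ⊗ δ : N ⊗ H ⟶ N ⊗ H ⊗ H`. -/
def comulLin (N : RightMod A.alg) : A.tensorH N ⟶ A.tensorH (A.tensorH N) :=
  (cofree A.entwining N).coactHom

/-- The canonical epimorphism `N ⊗ A ⟶ N ⊗_{A^H} A`. -/
def resπ (N : RightMod A.alg) : N.X ⊗ A.alg.X ⟶ (A.ind.obj (A.res N)).X := A.indπ (A.res N)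

instance (N : RightMod A.alg) : Epi (A.resπ N) := inferInstanceAs (Epi (A.indπ (A.res N)))

/-- The unit `N ⟶ N ⊗_{A^H} A`. -/
def resUnit (N : RightMod A.alg) : N.X ⟶ (A.ind.obj (A.res N)).X := A.indUnit (A.res N)

lemma resUnit_canMap (N : RightMod A.alg) : A.resUnit N ≫ A.canMap N = tensorUnit N.X :=
  A.indUnit_FbarDesc (X := A.res N) (M := cofree A.entwining N) (tensorUnit N.X)
    (A.act_tensorUnit N) (tensorUnit_comul N.X)

lemma resπ_canMap (N : RightMod A.alg) : A.resπ N ≫ A.canMap N =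
    N.X ◁ A.coact ≫ (α_ N.X A.alg.X H).inv ≫ N.act ▷ H :=
  (A.indπ_indDescHom (X := A.res N) (N := A.tensorH N) (tensorUnit N.X)
    (A.act_tensorUnit N)).trans (A.tensorUnit_act N)

/-- Both sides are induced by the same morphism on A ⊗ A. This ties the family of canonical
morphisms to the Galois condition. -/
lemma canMap_regular : A.canMap (RightMod.regular A.alg) = A.can := by
  have : Epi (A.resπ (RightMod.regular A.alg)) := inferInstance
  apply this.left_cancellation
  change _ = relTensor.π _ A.bimod ≫ A.can
  rw [can, relTensor.π_desc]
  exact A.resπ_canMap _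

/-- For an entwined module `M`, the two morphisms `M ⊗_{A^H} A ⇉ (M ⊗ H) ⊗_{A^H} A` correspond to
`ν ⊗ H` and `M ⊗ δ`. -/
lemma ind_map_coactHom_canLin (M : EntwinedModule A.entwining) :
    A.ind.map (RightMod.restrictMap A.incl M.coactHom) ≫ A.canLin (A.tensorH M.toRightMod) =
      A.canLin M.toRightMod ≫ tensorRightModMap A.entwining M.coactHom := by
  apply A.ind_hom_ext
  rw [RightMod.comp_hom, RightMod.comp_hom, reassoc_of% A.indUnit_map]
  have h1 := A.resUnit_canMap M.toRightMod
  have h2 := A.resUnit_canMap (A.tensorH M.toRightMod)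
  change M.coact ≫ A.resUnit (A.tensorH M.toRightMod) ≫ A.canMap (A.tensorH M.toRightMod) =
    A.resUnit M.toRightMod ≫ A.canMap M.toRightMod ≫ M.coact ▷ H
  calc _ = M.coact ≫ tensorUnit (M.X ⊗ H) := congrArg (M.coact ≫ ·) h2
    _ = _ := by rw [← tensorUnit_naturality, reassoc_of% h1]

/-- Both sides are determined on n ⊗ 1, where they give n ⊗ e_H ⊗ e_H because e_H is grouplike. -/
lemma ind_map_tensorUnitHom_canLin (N : RightMod A.alg) :
    A.ind.map (A.tensorUnitHom N) ≫ A.canLin (A.tensorH N) =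
      A.canLin N ≫ A.comulLin N := by
  apply A.ind_hom_ext
  rw [RightMod.comp_hom, RightMod.comp_hom, reassoc_of% A.indUnit_map]
  have h1 := A.resUnit_canMap N
  have h2 := A.resUnit_canMap (A.tensorH N)
  change tensorUnit N.X ≫ A.resUnit (A.tensorH N) ≫ A.canMap (A.tensorH N) =
    A.resUnit N ≫ A.canMap N ≫ N.X ◁ Δ[H] ≫ (α_ N.X H H).inv
  calc _ = tensorUnit N.X ≫ tensorUnit (N.X ⊗ H) := congrArg (tensorUnit N.X ≫ ·) h2
    _ = _ := by rw [← tensorUnit_comul, reassoc_of% h1]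

/-! ### Counit, unit, and the criterion for an equivalence. -/

/-- The counit `M^H ⊗_{A^H} A ⟶ M` for an entwined module `M`. -/
def counit (M : EntwinedModule A.entwining) : A.Fbar.obj (A.coinvariants M) ⟶ M :=
  A.FbarDesc (A.coinvariantsιHom M) (A.coinvariants_act M) (A.coinvariantsιHom_coact M)

/-- The counit `M^H ⊗_{A^H} A ⟶ M` as a morphism of right modules. -/
def counitLin (M : EntwinedModule A.entwining) :
    A.ind.obj (A.coinvariants M) ⟶ M.toRightMod :=
  (forget A.entwining).map (A.counit M)

lemma indUnit_counitLin (M : EntwinedModule A.entwining) :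
    A.indUnit (A.coinvariants M) ≫ (A.counitLin M).hom = A.coinvariantsιHom M :=
  A.indUnit_FbarDesc (A.coinvariantsιHom M) (A.coinvariants_act M) (A.coinvariantsιHom_coact M)

/-- On m ⊗ 1 with m coinvariant both sides give m ⊗ e_H. Up to the canonical morphism, the counit
followed by ν is thus the induced inclusion of M^H. -/
lemma counitLin_coactHom (M : EntwinedModule A.entwining) :
    A.counitLin M ≫ M.coactHom = A.ind.map (A.coinvariantsι M) ≫ A.canLin M.toRightMod := by
  apply A.ind_hom_ext
  rw [RightMod.comp_hom, RightMod.comp_hom, reassoc_of% A.indUnit_map,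
    reassoc_of% A.indUnit_counitLin]
  change A.coinvariantsιHom M ≫ M.coact =
    A.coinvariantsιHom M ≫ A.resUnit M.toRightMod ≫ A.canMap M.toRightMod
  rw [resUnit_canMap, coinvariantsιHom_coact]

/-- If `- ⊗_{A^H} A` preserves equalizers and the canonical morphisms are isomorphisms, then the
counit `M^H ⊗_{A^H} A ⟶ M` is an isomorphism. -/
lemma isIso_counitLin (hf : LeftFlat A.bimod)
    (hcan : ∀ N : RightMod A.alg, IsIso (A.canLin N)) (M : EntwinedModule A.entwining) :
    IsIso (A.counitLin M) := by
  have : PreservesLimitsOfShape WalkingParallelPair A.ind := hf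
  have := hcan M.toRightMod
  have := hcan (A.tensorH M.toRightMod)
  have := A.mono_coactHom M
  -- Flatness keeps the equalizer defining M^H an equalizer after induction.
  have hl := isLimitForkMapOfIsLimit A.ind _ (RightMod.isLimitEqualizer
    (RightMod.restrictMap A.incl M.coactHom) (A.tensorUnitHom M.toRightMod))
  -- `w` is the coaction transported along the inverse of the canonical morphism. Coassociativity
  -- (`hd`) shows that it equalizes the induced pair, so it lifts to the candidate inverse `l` of
  -- the counit.
  obtain ⟨w, hw⟩ : ∃ w : M.toRightMod ⟶ A.ind.obj (A.res M.toRightMod),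
      w ≫ A.canLin M.toRightMod = M.coactHom := ⟨M.coactHom ≫ inv (A.canLin M.toRightMod), by simp⟩
  have hd : M.coactHom ≫ tensorRightModMap A.entwining M.coactHom =
      M.coactHom ≫ A.comulLin M.toRightMod := by
    apply RightMod.hom_ext
    change M.coact ≫ M.coact ▷ H = M.coact ≫ M.X ◁ Δ[H] ≫ (α_ M.X H H).inv
    rw [reassoc_of% M.coact_comul]
    simp
  have hT : w ≫ A.ind.map (RightMod.restrictMap A.incl M.coactHom) =
      w ≫ A.ind.map (A.tensorUnitHom M.toRightMod) := by
    rw [← cancel_mono (A.canLin (A.tensorH M.toRightMod)), Category.assoc, Category.assoc]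
    have h1 := congrArg (w ≫ ·) (A.ind_map_coactHom_canLin M)
    have h2 := congrArg (w ≫ ·) (A.ind_map_tensorUnitHom_canLin M.toRightMod)
    refine h1.trans (Eq.trans ?_ h2.symm)
    simp only [reassoc_of% hw, hd]
  obtain ⟨l, hl2⟩ : ∃ l : M.toRightMod ⟶ A.ind.obj (A.coinvariants M),
      l ≫ A.ind.map (A.coinvariantsι M) = w :=
    ⟨Fork.IsLimit.lift hl w hT, Fork.IsLimit.lift_ι' hl w hT⟩
  have hm : Mono (A.ind.map (A.coinvariantsι M)) := mono_of_isLimit_fork hl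
  refine ⟨l, ?_, ?_⟩
  · rw [← cancel_mono (A.ind.map (A.coinvariantsι M)),
      ← cancel_mono (A.canLin M.toRightMod)]
    simp only [Category.assoc, reassoc_of% hl2, hw, counitLin_coactHom, Category.id_comp]
  · rw [← cancel_mono M.coactHom, Category.assoc, counitLin_coactHom, reassoc_of% hl2, hw,
      Category.id_comp]

/-- The underlying morphism of right modules of a morphism `X ⊗_{A^H} A ⟶ M`. -/
def FbarLin {X : RightMod A.coinv} {M : EntwinedModule A.entwining} (h : A.Fbar.obj X ⟶ M) :
    A.ind.obj X ⟶ M.toRightMod :=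
  (forget A.entwining).map h

lemma FbarLin_coact {X : RightMod A.coinv} {M : EntwinedModule A.entwining}
    (h : A.Fbar.obj X ⟶ M) : A.indCoact X ≫ (A.FbarLin h).hom ▷ H = (A.FbarLin h).hom ≫ M.coact :=
  h.coact_hom

/-- The restriction `X ⟶ M` of a morphism of entwined modules `X ⊗_{A^H} A ⟶ M` takes values in
the coinvariants. -/
lemma indUnit_FbarLin_coact {X : RightMod A.coinv} {M : EntwinedModule A.entwining}
    (h : A.Fbar.obj X ⟶ M) : (A.indUnit X ≫ (A.FbarLin h).hom) ≫ M.coact =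
      (A.indUnit X ≫ (A.FbarLin h).hom) ≫ tensorUnit M.X := by
  rw [Category.assoc, ← FbarLin_coact, reassoc_of% indUnit_coact, tensorUnit_naturality,
    Category.assoc]

lemma act_indUnit_hom {X : RightMod A.coinv} {N : RightMod A.alg} (f : A.ind.obj X ⟶ N) :
    X.act ≫ A.indUnit X ≫ f.hom =
      (A.indUnit X ≫ f.hom) ▷ A.coinv.X ≫ N.X ◁ A.incl.hom ≫ N.act := by
  rw [reassoc_of% act_indUnit, f.act_hom, comp_whiskerRight_assoc,
    ← whisker_exchange_assoc f.hom]

/-- The morphism of right `A^H`-modules `X ⟶ M^H` corresponding to a morphism of entwined modules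
`X ⊗_{A^H} A ⟶ M`. -/
def coinvariantsAdj {X : RightMod A.coinv} {M : EntwinedModule A.entwining}
    (h : A.Fbar.obj X ⟶ M) : X ⟶ A.coinvariants M :=
  A.coinvariantsLift M (A.indUnit X ≫ (A.FbarLin h).hom) (A.act_indUnit_hom _)
    (A.indUnit_FbarLin_coact h)

lemma coinvariantsAdj_ι {X : RightMod A.coinv} {M : EntwinedModule A.entwining}
    (h : A.Fbar.obj X ⟶ M) : (A.coinvariantsAdj h).hom ≫ A.coinvariantsιHom M =
      A.indUnit X ≫ (A.FbarLin h).hom :=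
  A.coinvariantsLift_ι M _ _ _

/-- Both sides have the same values on x ⊗ 1. For the identity of `Fbar` X this is a triangle
identity; in general it yields fullness. -/
lemma coinvariantsAdj_counit {X : RightMod A.coinv} {M : EntwinedModule A.entwining}
    (h : A.Fbar.obj X ⟶ M) : A.Fbar.map (A.coinvariantsAdj h) ≫ A.counit M = h := by
  apply A.Fbar_hom_ext
  have h1 := A.indUnit_map (A.coinvariantsAdj h)
  have h2 := A.indUnit_counitLin M
  change A.indUnit X ≫ (A.ind.map (A.coinvariantsAdj h)).hom ≫ (A.counitLin M).hom =
    A.indUnit X ≫ (A.FbarLin h).hom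
  rw [reassoc_of% h1, h2, coinvariantsAdj_ι]

/-- If the counits are isomorphisms and `- ⊗_{A^H} A` is conservative, then the functor `Fbar` is
an equivalence. -/
lemma isEquivalence_Fbar (hr : A.ind.ReflectsIsomorphisms)
    (hc : ∀ M : EntwinedModule A.entwining, IsIso (A.counitLin M)) :
    A.Fbar.IsEquivalence := by
  have hc' (M : EntwinedModule A.entwining) : IsIso (A.counit M) := by
    have : IsIso ((forget A.entwining).map (A.counit M)) := hc M
    exact isIso_of_reflects_iso _ (forget A.entwining)
  let u (X : RightMod A.coinv) : X ⟶ A.coinvariants (A.Fbar.obj X) := A.coinvariantsAdj (𝟙 _)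
  have hu (X) : A.Fbar.map (u X) ≫ A.counit _ = 𝟙 _ := A.coinvariantsAdj_counit _
  have hFu (X) : A.Fbar.map (u X) = inv (A.counit _) := by
    rw [← cancel_mono (A.counit _), hu, IsIso.inv_hom_id]
  -- The triangle identity exhibits `Fbar` of the unit as the inverse of a counit, and
  -- conservativity of induction then makes the unit itself invertible.
  have hui (X) : IsIso (u X) := by
    have : IsIso (A.Fbar.map (u X)) := by rw [hFu]; infer_instance
    have : IsIso (A.ind.map (u X)) :=
      inferInstanceAs (IsIso ((forget A.entwining).map (A.Fbar.map (u X))))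
    exact isIso_of_reflects_iso _ A.ind
  exact
    { faithful := ⟨fun {X Y} f g hfg => by
        rw [← cancel_mono (u Y)]
        apply RightMod.hom_ext
        have hι : Mono (A.coinvariantsιHom (A.Fbar.obj Y)) := RightMod.mono_equalizerι _ _
        -- The unit followed by the inclusion of coinvariants is y ↦ y ⊗ 1, so naturality recovers f
        -- followed by the unit from the induced morphism of f.
        have huY : (u Y).hom ≫ A.coinvariantsιHom (A.Fbar.obj Y) = A.indUnit Y :=
          (A.coinvariantsAdj_ι _).trans (Category.comp_id _)
        have hfg' : A.ind.map f = A.ind.map g := congrArg (forget A.entwining).map hfg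
        have h1 : f.hom ≫ A.indUnit Y = g.hom ≫ A.indUnit Y := by
          rw [← indUnit_map, ← indUnit_map, hfg']
        rw [← cancel_mono (A.coinvariantsιHom (A.Fbar.obj Y)), RightMod.comp_hom,
          RightMod.comp_hom, Category.assoc, Category.assoc, huY]
        exact h1⟩
      full := ⟨fun {X Y} h => ⟨A.coinvariantsAdj h ≫ inv (u Y), by
        rw [Functor.map_comp, Functor.map_inv, IsIso.comp_inv_eq, hFu, IsIso.eq_comp_inv,
          coinvariantsAdj_counit]⟩⟩
      essSurj := ⟨fun M => ⟨A.coinvariants M, ⟨asIso (A.counit M)⟩⟩⟩ }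

/-! ### An equivalence forces the canonical morphisms to be invertible. -/

lemma indUnit_map_canLin {X : RightMod A.coinv} {N : RightMod A.alg} (f : X ⟶ A.res N)
    {g : X.X ⟶ N.X} (h : f.hom = g) :
    A.indUnit X ≫ (A.ind.map f ≫ A.canLin N).hom = g ≫ tensorUnit N.X := by
  have h1 := A.indUnit_map f
  rw [RightMod.comp_hom, reassoc_of% h1, h]
  exact congrArg (g ≫ ·) (A.resUnit_canMap N)

/-- If `Fbar` is an equivalence, then the canonical morphisms are isomorphisms. -/
lemma isIso_canHom [A.Fbar.IsEquivalence] (N : RightMod A.alg) : IsIso (A.canHom N) := by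
  let X := A.Fbar.objPreimage (cofree A.entwining N)
  let j : A.Fbar.obj X ≅ cofree A.entwining N := A.Fbar.objObjPreimageIso (cofree A.entwining N)
  let g : A.ind.obj X ⟶ A.tensorH N := A.FbarLin j.hom
  let k : A.ind.obj X ⟶ N := g ≫ tensorRightModCounit A.entwining N
  -- On x ⊗ 1 the isomorphism `j` takes coinvariant values in N ⊗ H, hence values n ⊗ e_H; applying
  -- ε_H extracts n, and this defines `t`. So `j` factors through the canonical morphism.
  let t : X ⟶ A.res N := ⟨A.indUnit X ≫ k.hom, A.act_indUnit_hom k⟩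
  let g' : (A.ind.obj X).X ⟶ N.X ⊗ H := g.hom
  have hg : (A.indUnit X ≫ g') ≫ N.X ◁ Δ[H] ≫ (α_ N.X H H).inv =
      (A.indUnit X ≫ g') ≫ tensorUnit (N.X ⊗ H) := A.indUnit_FbarLin_coact j.hom
  have hk : A.indUnit X ≫ k.hom = (A.indUnit X ≫ g') ≫ N.X ◁ ε[H] ≫ (ρ_ N.X).hom :=
    (Category.assoc _ _ _).symm
  have ht : A.Fbar.map t ≫ A.canHom N = j.hom := by
    apply A.Fbar_hom_ext
    refine (A.indUnit_map_canLin t rfl).trans (Eq.trans ?_ (rfl : A.indUnit X ≫ g' = _))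
    exact (congrArg (· ≫ tensorUnit N.X) hk).trans (comp_counit_tensorUnit _ hg)
  have hs : (j.inv ≫ A.Fbar.map t) ≫ A.canHom N = 𝟙 _ := by rw [Category.assoc, ht, j.inv_hom_id]
  refine ⟨j.inv ≫ A.Fbar.map t, ?_, hs⟩
  -- The idempotent left over from the section comes from some `f` by fullness. Composing with the
  -- canonical morphism absorbs it, so f(n) ⊗ e_H = n ⊗ e_H, and ε_H gives f(n) = n.
  obtain ⟨f, hf⟩ := A.Fbar.map_surjective (A.canHom N ≫ j.inv ≫ A.Fbar.map t)
  have hf2 : A.Fbar.map f ≫ A.canHom N = A.canHom N := by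
    rw [hf, Category.assoc, hs, Category.comp_id]
  let f' : N.X ⟶ N.X := f.hom
  have h3 : f' ≫ tensorUnit (H := H) N.X = tensorUnit N.X :=
    (A.indUnit_map_canLin f rfl).symm.trans ((congrArg
      (fun q => A.indUnit (A.res N) ≫ ((forget A.entwining).map q).hom) hf2).trans
        (A.resUnit_canMap N))
  have h4 : f' = 𝟙 N.X := by
    rw [← Category.comp_id f', ← tensorUnit_counit (H := H) N.X, reassoc_of% h3]
  have h5 : f = 𝟙 _ := RightMod.hom_ext h4
  rw [← hf, h5, A.Fbar.map_id]

end Canonical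

end ComoduleAlgebra

end

/-! ### The Galois condition makes every canonical morphism invertible. -/

section

variable {V : Type u} [Category.{v} V] [MonoidalCategory V]

section DescLeft

variable [HasCoequalizers V] [∀ X : V, PreservesColimitsOfShape WalkingParallelPair (tensorLeft X)]
  {S T : Mon V} (X : RightMod S) (M : Bimod S T) {Z W : V} (k : Z ⊗ (X.X ⊗ M.X) ⟶ W)
  (hk : Z ◁ (X.act ▷ M.X) ≫ k = Z ◁ (α_ X.X S.X M.X).hom ≫ Z ◁ (X.X ◁ M.actLeft) ≫ k)

/-- The morphism out of `Z ⊗ (X ⊗_S M)` induced by an `S`-balanced morphism; it exists since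
`Z ⊗ -` preserves coequalizers. -/
def relTensor.descLeft : Z ⊗ relTensor X M ⟶ W :=
  (PreservesCoequalizer.iso (tensorLeft Z) _ _).inv ≫ coequalizer.desc k (by simpa using hk)

lemma relTensor.π_descLeft : Z ◁ relTensor.π X M ≫ relTensor.descLeft X M k hk = k :=
  map_π_preserves_coequalizer_inv_desc (tensorLeft Z) _ _ k _

lemma relTensor.epi_whiskerLeft_π (Z : V) : Epi (Z ◁ relTensor.π X M) :=
  inferInstanceAs (Epi ((tensorLeft Z).map (coequalizer.π _ _)))

end DescLeft

variable [BraidedCategory V]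

namespace ComoduleAlgebra

open EntwinedModule

variable [HasEqualizers V] [HasCoequalizers V]
variable [∀ X : V, PreservesColimitsOfShape WalkingParallelPair (tensorRight X)]
variable {H : V} [BimonObj H] (A : ComoduleAlgebra H)

/-- The object `A ⊗_{A^H} A`. -/
def selfTensor : V := (A.ind.obj (A.res (RightMod.regular A.alg))).X

/-- The canonical epimorphism `A ⊗ A ⟶ A ⊗_{A^H} A`. -/
def selfπ : A.alg.X ⊗ A.alg.X ⟶ A.selfTensor := A.resπ (RightMod.regular A.alg)

instance : Epi A.selfπ := inferInstanceAs (Epi (A.resπ (RightMod.regular A.alg)))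

/-- The canonical morphism `A ⊗_{A^H} A ⟶ A ⊗ H`. -/
def selfCan : A.selfTensor ⟶ A.alg.X ⊗ H := A.canMap (RightMod.regular A.alg)

lemma selfπ_selfCan : A.selfπ ≫ A.selfCan =
    A.alg.X ◁ A.coact ≫ (α_ A.alg.X A.alg.X H).inv ≫ μ[A.alg.X] ▷ H :=
  A.resπ_canMap (RightMod.regular A.alg)

lemma resπ_condition (N : RightMod A.alg) :
    (N.X ◁ A.incl.hom ≫ N.act) ▷ A.alg.X ≫ A.resπ N = (α_ N.X A.coinv.X A.alg.X).hom ≫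
      N.X ◁ (A.incl.hom ▷ A.alg.X ≫ μ[A.alg.X]) ≫ A.resπ N :=
  A.indπ_condition (A.res N)

variable [∀ X : V, PreservesColimitsOfShape WalkingParallelPair (tensorLeft X)]

instance (Z : V) : Epi (Z ◁ A.selfπ) := relTensor.epi_whiskerLeft_π _ _ Z

/-- The morphism `N ⊗ (A ⊗_{A^H} A) ⟶ N ⊗_{A^H} A` induced by the action of `A` on `N`. -/
def selfAct (N : RightMod A.alg) : N.X ⊗ A.selfTensor ⟶ (A.ind.obj (A.res N)).X :=
  relTensor.descLeft (A.res (RightMod.regular A.alg)) A.bimod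
    ((α_ N.X A.alg.X A.alg.X).inv ≫ N.act ▷ A.alg.X ≫ A.resπ N) (by
    change N.X ◁ ((A.alg.X ◁ A.incl.hom ≫ μ[A.alg.X]) ▷ A.alg.X) ≫
        (α_ N.X A.alg.X A.alg.X).inv ≫ N.act ▷ A.alg.X ≫ A.resπ N =
      N.X ◁ (α_ A.alg.X A.coinv.X A.alg.X).hom ≫
        N.X ◁ (A.alg.X ◁ (A.incl.hom ▷ A.alg.X ≫ μ[A.alg.X])) ≫
        (α_ N.X A.alg.X A.alg.X).inv ≫ N.act ▷ A.alg.X ≫ A.resπ N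
    calc _ = 𝟙 _ ⊗≫ N.X ◁ A.alg.X ◁ A.incl.hom ▷ A.alg.X ⊗≫
          (N.X ◁ μ[A.alg.X] ≫ N.act) ▷ A.alg.X ≫ A.resπ N := by monoidal
      _ = 𝟙 _ ⊗≫ ((N.X ⊗ A.alg.X) ◁ A.incl.hom ≫ N.act ▷ A.alg.X) ▷ A.alg.X ⊗≫
          N.act ▷ A.alg.X ≫ A.resπ N := by rw [N.act_mul]; monoidal
      _ = 𝟙 _ ⊗≫ N.act ▷ A.coinv.X ▷ A.alg.X ⊗≫
          (N.X ◁ A.incl.hom ≫ N.act) ▷ A.alg.X ≫ A.resπ N := by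
            rw [whisker_exchange]; monoidal
      _ = 𝟙 _ ⊗≫ (N.act ▷ (A.coinv.X ⊗ A.alg.X) ≫
          N.X ◁ (A.incl.hom ▷ A.alg.X ≫ μ[A.alg.X])) ≫ A.resπ N := by
            rw [resπ_condition]; monoidal
      _ = _ := by rw [← whisker_exchange]; monoidal)

lemma selfπ_selfAct (N : RightMod A.alg) : N.X ◁ A.selfπ ≫ A.selfAct N =
    (α_ N.X A.alg.X A.alg.X).inv ≫ N.act ▷ A.alg.X ≫ A.resπ N :=
  relTensor.π_descLeft _ _ _ _

/-- Associativity of the action: both sides send n ⊗ (a ⊗ b) to n a b_0 ⊗ b_1. This replaces the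
identification of can_N with N ⊗_A can. -/
lemma selfAct_canMap (N : RightMod A.alg) : A.selfAct N ≫ A.canMap N =
    N.X ◁ A.selfCan ≫ (α_ N.X A.alg.X H).inv ≫ N.act ▷ H := by
  rw [← cancel_epi (N.X ◁ A.selfπ), reassoc_of% selfπ_selfAct, resπ_canMap,
    ← MonoidalCategory.whiskerLeft_comp_assoc, selfπ_selfCan, ← whisker_exchange_assoc]
  calc _ = 𝟙 _ ⊗≫ N.X ◁ A.alg.X ◁ A.coact ⊗≫
        ((α_ N.X A.alg.X A.alg.X).inv ≫ N.act ▷ A.alg.X ≫ N.act) ▷ H := by monoidal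
    _ = _ := by rw [← N.act_mul]; monoidal

/-- The left action of `A` on `A ⊗_{A^H} A`. -/
def selfLeft : A.alg.X ⊗ A.selfTensor ⟶ A.selfTensor := A.selfAct (RightMod.regular A.alg)

lemma selfπ_selfLeft : A.alg.X ◁ A.selfπ ≫ A.selfLeft =
    (α_ A.alg.X A.alg.X A.alg.X).inv ≫ μ[A.alg.X] ▷ A.alg.X ≫ A.selfπ :=
  A.selfπ_selfAct (RightMod.regular A.alg)

lemma selfLeft_selfCan : A.selfLeft ≫ A.selfCan =
    A.alg.X ◁ A.selfCan ≫ (α_ A.alg.X A.alg.X H).inv ≫ μ[A.alg.X] ▷ H :=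
  A.selfAct_canMap (RightMod.regular A.alg)

lemma selfLeft_selfAct (N : RightMod A.alg) : N.X ◁ A.selfLeft ≫ A.selfAct N =
    (α_ N.X A.alg.X A.selfTensor).inv ≫ N.act ▷ A.selfTensor ≫ A.selfAct N := by
  -- Up to associators this is (N ⊗ A) ⊗ π, an epimorphism because tensoring on the left preserves
  -- coequalizers.
  have : Epi (N.X ◁ A.alg.X ◁ A.selfπ) := by
    have h : N.X ◁ A.alg.X ◁ A.selfπ =
        (α_ _ _ _).inv ≫ (N.X ⊗ A.alg.X) ◁ A.selfπ ≫ (α_ _ _ _).hom := by simp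
    rw [h]
    infer_instance
  rw [← cancel_epi (N.X ◁ A.alg.X ◁ A.selfπ), ← MonoidalCategory.whiskerLeft_comp_assoc,
    selfπ_selfLeft]
  calc _ = 𝟙 _ ⊗≫ N.X ◁ (μ[A.alg.X] ▷ A.alg.X) ≫ N.X ◁ A.selfπ ≫ A.selfAct N := by monoidal
    _ = 𝟙 _ ⊗≫ (N.X ◁ μ[A.alg.X] ≫ N.act) ▷ A.alg.X ≫ A.resπ N := by
        rw [selfπ_selfAct]; monoidal
    _ = 𝟙 _ ⊗≫ N.act ▷ (A.alg.X ⊗ A.alg.X) ⊗≫ N.act ▷ A.alg.X ≫ A.resπ N := by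
        rw [N.act_mul]; monoidal
    _ = 𝟙 _ ⊗≫ (N.act ▷ (A.alg.X ⊗ A.alg.X) ≫ N.X ◁ A.selfπ) ≫ A.selfAct N := by
        rw [Category.assoc, selfπ_selfAct]; monoidal
    _ = _ := by rw [← whisker_exchange]; monoidal

/-- If `A` is `H`-Galois, then the canonical morphism `N ⊗_{A^H} A ⟶ N ⊗ H` is an isomorphism for
every right `A`-module `N`. -/
lemma isIso_canMap (h : A.IsGalois) (N : RightMod A.alg) : IsIso (A.canMap N) := by
  have hc : IsIso A.selfCan := by
    have : A.selfCan = A.can := A.canMap_regular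
    rw [this]; exact h
  let c := inv A.selfCan
  have hc1 : c ≫ A.selfCan = 𝟙 _ := IsIso.inv_hom_id _
  have hc2 : A.selfCan ≫ c = 𝟙 _ := IsIso.hom_inv_id _
  -- the inverse of `can` is left `A`-linear
  have hcl : A.alg.X ◁ c ≫ A.selfLeft = (α_ A.alg.X A.alg.X H).inv ≫ μ[A.alg.X] ▷ H ≫ c := by
    rw [← cancel_mono A.selfCan, Category.assoc, selfLeft_selfCan]
    simp only [Category.assoc]
    rw [← MonoidalCategory.whiskerLeft_comp_assoc, hc1]
    simp
  -- `can` sends `1 ⊗ a` to the coaction of `a`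
  have hcoact : A.coact ≫ c = (λ_ A.alg.X).inv ≫ η[A.alg.X] ▷ A.alg.X ≫ A.selfπ := by
    rw [← cancel_mono A.selfCan, Category.assoc, hc1, Category.assoc, Category.assoc,
      selfπ_selfCan, ← whisker_exchange_assoc]
    calc _ = A.coact ≫ 𝟙 _ ⊗≫ 𝟙 _ := by monoidal
      _ = (λ_ A.alg.X).inv ≫ 𝟙_ V ◁ A.coact ⊗≫ (η[A.alg.X] ▷ A.alg.X ≫ μ[A.alg.X]) ▷ H := by
          rw [MonObj.one_mul]; monoidal
      _ = _ := by monoidal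
  -- The inverse is n ⊗ h ↦ n · can⁻¹(1 ⊗ h).
  let s : N.X ⊗ H ⟶ (A.ind.obj (A.res N)).X :=
    N.X ◁ ((λ_ H).inv ≫ η[A.alg.X] ▷ H ≫ c) ≫ A.selfAct N
  -- `s` is compatible with the action
  have hs : (α_ N.X A.alg.X H).inv ≫ N.act ▷ H ≫ s = N.X ◁ c ≫ A.selfAct N := by
    calc _ = (α_ N.X A.alg.X H).inv ≫ (N.act ▷ H ≫ N.X ◁ ((λ_ H).inv ≫ η[A.alg.X] ▷ H ≫ c)) ≫
          A.selfAct N := by simp only [s, Category.assoc]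
      _ = 𝟙 _ ⊗≫ N.X ◁ A.alg.X ◁ ((λ_ H).inv ≫ η[A.alg.X] ▷ H ≫ c) ≫
          (α_ N.X A.alg.X A.selfTensor).inv ≫ N.act ▷ A.selfTensor ≫ A.selfAct N := by
          rw [← whisker_exchange]; monoidal
      _ = 𝟙 _ ⊗≫ N.X ◁ A.alg.X ◁ ((λ_ H).inv ≫ η[A.alg.X] ▷ H) ⊗≫
          N.X ◁ (A.alg.X ◁ c ≫ A.selfLeft) ≫ A.selfAct N := by
          rw [← selfLeft_selfAct]; monoidal
      _ = 𝟙 _ ⊗≫ N.X ◁ (A.alg.X ◁ η[A.alg.X] ≫ μ[A.alg.X]) ▷ H ⊗≫ N.X ◁ c ≫ A.selfAct N := by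
          rw [hcl]; monoidal
      _ = _ := by rw [MonObj.mul_one]; monoidal
  refine ⟨s, ?_, ?_⟩
  · rw [← cancel_epi (A.resπ N), reassoc_of% resπ_canMap, hs,
      ← MonoidalCategory.whiskerLeft_comp_assoc, hcoact]
    calc _ = 𝟙 _ ⊗≫ N.X ◁ η[A.alg.X] ▷ A.alg.X ≫ N.X ◁ A.selfπ ≫ A.selfAct N := by monoidal
      _ = 𝟙 _ ⊗≫ (N.X ◁ η[A.alg.X] ≫ N.act) ▷ A.alg.X ≫ A.resπ N := by
          rw [selfπ_selfAct]; monoidal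
      _ = _ := by rw [N.act_one]; monoidal
  · simp only [s, Category.assoc]
    rw [selfAct_canMap, ← MonoidalCategory.whiskerLeft_comp_assoc, Category.assoc, Category.assoc,
      hc1]
    calc _ = 𝟙 _ ⊗≫ (N.X ◁ η[A.alg.X] ≫ N.act) ▷ H := by monoidal
      _ = _ := by rw [N.act_one]; monoidal

end ComoduleAlgebra

end

end BraidedGalois

end

theorem theorem5p13 {V : Type u} [Category.{v} V] [MonoidalCategory V] [BraidedCategory V]
    [HasEqualizers V] [HasCoequalizers V]
    [∀ X : V, PreservesColimitsOfShape WalkingParallelPair (tensorLeft X)]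
    [∀ X : V, PreservesColimitsOfShape WalkingParallelPair (tensorRight X)]
    (H : V) [BimonObj H] (A : BraidedGalois.ComoduleAlgebra H)
    (hH : BraidedGalois.FlatObj H) :
    A.Fbar.IsEquivalence ↔ A.IsGalois ∧ BraidedGalois.LeftFaithfullyFlat A.bimod := by
  constructor
  · intro h
    refine ⟨?_, ?_, ?_⟩
    · have := A.isIso_canHom (BraidedGalois.RightMod.regular A.alg)
      have h2 : IsIso (A.canMap (BraidedGalois.RightMod.regular A.alg)) :=
        BraidedGalois.EntwinedModule.isIso_hom (A.canHom (BraidedGalois.RightMod.regular A.alg))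
      rw [A.canMap_regular] at h2
      exact h2
    -- The composite `Fbar` ⋙ `forget` is definitionally - ⊗_{A^H} A, so conservativity here and
    -- preservation of equalizers below are inherited from the two factors.
    · exact inferInstanceAs
        (A.Fbar ⋙ BraidedGalois.EntwinedModule.forget A.entwining).ReflectsIsomorphisms
    · have := BraidedGalois.EntwinedModule.preservesLimitsOfShape_forget (E := A.entwining) hH
      exact inferInstanceAs (PreservesLimitsOfShape WalkingParallelPair
        (A.Fbar ⋙ BraidedGalois.EntwinedModule.forget A.entwining))
  · rintro ⟨hg, hr, hf⟩
    refine A.isEquivalence_Fbar hr (A.isIso_counitLin hf fun N => ?_)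
    have : IsIso (BraidedGalois.RightMod.Hom.hom (A.canLin N)) := A.isIso_canMap hg N
    exact BraidedGalois.RightMod.isIso_of_isIso_hom _
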